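/- Let $A$ be a finite alphabet with $|A|\ge 2$ and let $k\ge 1$ be an integer. An $A$-generated $k$-relation monoid presentation is a sequence $R=((x_1,y_1),\dots,(x_k,y_k))$ of $k$ ordered pairs of words $x_i,y_i\in A^*$; for a semigroup presentation the words $x_i,y_i$ are required to be non-empty. Write $u\equiv_R v$ if there is a finite sequence of words (non-empty words, in the semigroup case) from $u$ to $v$ in which any two consecutive words have the form $axb$, $ayb$ with $a,b\in A^*$ (possibly empty) and $(x,y)\in R$ or $(y,x)\in R$. The word problem for a fixed presentation is to decide, given two words $u,v$ in $A^*$ (in $A^+$, in the semigroup case), whether $u\equiv_R v$. It is solvable in linear time if there are a (multi-stack, equivalently multi-tape) deterministic Turing machine and a constant $C$, both allowed to depend on the presentation, such that on input $u\#v$ the machine halts within $C(|u|+|v|+1)$ steps and outputs whether $u\equiv_R v$. Let the size of a presentation be either the sum of the lengths of its $2k$ relation words (sum length stratification) or the length of its longest relation word (maximum length stratification), and let $S_n$ be the finite set of presentations of size $n$. A set $X$ of presentations is generic if $|X\cap S_n|/|S_n|\to 1$ as $n\to\infty$. Theorem. With respect to either the sum length stratification or the maximum length stratification, the generic $A$-generated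 $k$-relation monoid presentation has word problem solvable in linear time; that is, there is a generic set of such presentations every member of which has word problem solvable in linear time. The corresponding statement for $A$-generated $k$-relation semigroup presentations also holds, with respect to either stratification. -/

import Mathlib

open Filter Topology

/-! ### Stratified sets and genericity -/

/-- A stratification of `S`: a sequence of finite subsets of `S` whose union is `S`. -/
structure Stratification (S : Type) where
  level : ℕ → Set S
  finite_level : ∀ n, (level n).Finite
  iUnion_level : ⋃ n, level n = Set.univ

/-- `X` is generic: the proportion of the `n`-th level lying in `X` tends to `1`.
(Finitely many levels may be empty; the convention `0 / 0 = 0` there does not affect the limit.) -/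
def Stratification.IsGeneric {S : Type} (σ : Stratification S) (X : Set S) : Prop :=
  Tendsto (fun n => ((X ∩ σ.level n).ncard : ℝ) / ((σ.level n).ncard : ℝ)) atTop (𝓝 1)

/-- "The generic element of `S` has property `p`": there is a generic subset of `S`, every member
of which has property `p`. -/
def Stratification.GenericHas {S : Type} (σ : Stratification S) (p : S → Prop) : Prop :=
  ∃ X : Set S, σ.IsGeneric X ∧ ∀ x ∈ X, p x

/-- The stratification by a size function: the `n`-th level consists of the elements of size `n`. -/
def Stratification.ofSize {S : Type} (size : S → ℕ) (h : ∀ n, {x | size x = n}.Finite) :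
    Stratification S where
  level n := {x | size x = n}
  finite_level := h
  iUnion_level := Set.eq_univ_of_forall fun x => Set.mem_iUnion.2 ⟨size x, rfl⟩

/-! ### Linear-time decidability -/

open Classical in
/-- The predicate `P`, with instances encoded as strings by `enc`, is decided in linear time: some
(multi-stack) Turing machine halts on the encoding of every instance with the truth value of `P` as
its output, after a number of steps that is at most linear in the length of the encoding. -/
def DecidableInLinearTime {α Γ : Type} (enc : α → List Γ) (P : α → Prop) : Prop :=
  ∃ M : Turing.TM2ComputableInTime enc Computability.encodeBool (fun a => decide (P a)),
    ∃ C : ℕ, ∀ n, M.time n ≤ C * (n + 1)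

/-- A pair of words `(u, v)` over `A`, written as the string `u # v`, where the separator `#` is
the extra symbol `none`. Its length is `|u| + |v| + 1`. -/
def encodeWordPair {A : Type} (p : List A × List A) : List (Option A) :=
  p.1.map some ++ none :: p.2.map some

/-! ### Monoid presentations -/

/-- `k`-relation monoid presentations over `A`: sequences of `k` ordered pairs of words. -/
abbrev MonoidPresentation (A : Type) (k : ℕ) : Type := Fin k → List A × List A

namespace MonoidPresentation

variable {A : Type} {k : ℕ}

/-- `u = a x b` and `v = a y b` for some relation `(x, y)` or `(y, x)`. -/
def OneStep (P : MonoidPresentation A k) (u v : List A) : Prop :=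
  ∃ (a b x y : List A) (i : Fin k),
    (P i = (x, y) ∨ P i = (y, x)) ∧ u = a ++ x ++ b ∧ v = a ++ y ++ b

/-- `u` and `v` are joined by a finite sequence of words, consecutive ones one-step equivalent. -/
def Equivalent (P : MonoidPresentation A k) : List A → List A → Prop :=
  Relation.ReflTransGen P.OneStep

/-- The word problem (input: two words) is solvable in time linear in the word lengths. -/
def WordProblemLinearTime (P : MonoidPresentation A k) : Prop :=
  DecidableInLinearTime (fun p : List A × List A => encodeWordPair p)
    (fun p => P.Equivalent p.1 p.2)

/-- The sum of the lengths of the relation words. -/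
def sumLength (P : MonoidPresentation A k) : ℕ :=
  ∑ i, ((P i).1.length + (P i).2.length)

/-- The length of the longest relation word. -/
def maxLength (P : MonoidPresentation A k) : ℕ :=
  Finset.univ.sup fun i => max (P i).1.length (P i).2.length

theorem finite_bounded [Finite A] (k n : ℕ) :
    {P : MonoidPresentation A k | ∀ i, (P i).1.length ≤ n ∧ (P i).2.length ≤ n}.Finite := by
  have h := Set.Finite.pi' (fun _ : Fin k =>
    (List.finite_length_le A n).prod (List.finite_length_le A n))
  exact h.subset fun P hP i => ⟨(hP i).1, (hP i).2⟩

theorem finite_maxLength [Finite A] (n : ℕ) :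
    {P : MonoidPresentation A k | P.maxLength = n}.Finite := by
  refine (finite_bounded k n).subset fun P hP i => ?_
  have h : max (P i).1.length (P i).2.length ≤ P.maxLength :=
    Finset.le_sup (f := fun i => max (P i).1.length (P i).2.length) (Finset.mem_univ i)
  have hP' : P.maxLength = n := hP
  omega

theorem finite_sumLength [Finite A] (n : ℕ) :
    {P : MonoidPresentation A k | P.sumLength = n}.Finite := by
  refine (finite_bounded k n).subset fun P hP i => ?_
  have h : (P i).1.length + (P i).2.length ≤ P.sumLength :=
    Finset.single_le_sum (f := fun i => (P i).1.length + (P i).2.length)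
      (fun _ _ => Nat.zero_le _) (Finset.mem_univ i)
  have hP' : P.sumLength = n := hP
  omega

/-- The sum length stratification. -/
def sumLengthStratification (A : Type) [Finite A] (k : ℕ) :
    Stratification (MonoidPresentation A k) :=
  .ofSize sumLength finite_sumLength

/-- The maximum length stratification. -/
def maxLengthStratification (A : Type) [Finite A] (k : ℕ) :
    Stratification (MonoidPresentation A k) :=
  .ofSize maxLength finite_maxLength

end MonoidPresentation

/-! ### Semigroup presentations -/

/-- Non-empty words over `A`. -/
abbrev NonemptyWord (A : Type) : Type := {w : List A // w ≠ []}

/-- `k`-relation semigroup presentations over `A`: sequences of `k` ordered pairs of non-empty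
words. -/
abbrev SemigroupPresentation (A : Type) (k : ℕ) : Type :=
  Fin k → NonemptyWord A × NonemptyWord A

namespace SemigroupPresentation

variable {A : Type} {k : ℕ}

/-- `u = a x b` and `v = a y b` for some relation `(x, y)` or `(y, x)` and some, possibly empty,
words `a` and `b`. -/
def OneStep (P : SemigroupPresentation A k) (u v : NonemptyWord A) : Prop :=
  ∃ (a b : List A) (x y : NonemptyWord A) (i : Fin k),
    (P i = (x, y) ∨ P i = (y, x)) ∧ u.1 = a ++ x.1 ++ b ∧ v.1 = a ++ y.1 ++ b

/-- `u` and `v` are joined by a finite sequence of non-empty words, consecutive ones one-step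
equivalent. -/
def Equivalent (P : SemigroupPresentation A k) : NonemptyWord A → NonemptyWord A → Prop :=
  Relation.ReflTransGen P.OneStep

/-- The word problem (input: two non-empty words) is solvable in time linear in the word
lengths. -/
def WordProblemLinearTime (P : SemigroupPresentation A k) : Prop :=
  DecidableInLinearTime (fun p : NonemptyWord A × NonemptyWord A => encodeWordPair (p.1.1, p.2.1))
    (fun p => P.Equivalent p.1 p.2)

/-- The same presentation, regarded as a monoid presentation. -/
def toMonoid (P : SemigroupPresentation A k) : MonoidPresentation A k :=
  fun i => ((P i).1.1, (P i).2.1)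

theorem toMonoid_injective :
    Function.Injective (toMonoid : SemigroupPresentation A k → MonoidPresentation A k) := by
  intro P Q h
  funext i
  have hi := congrFun h i
  exact Prod.ext (Subtype.ext (congrArg Prod.fst hi)) (Subtype.ext (congrArg Prod.snd hi))

/-- The sum of the lengths of the relation words. -/
def sumLength (P : SemigroupPresentation A k) : ℕ :=
  ∑ i, ((P i).1.1.length + (P i).2.1.length)

/-- The length of the longest relation word. -/
def maxLength (P : SemigroupPresentation A k) : ℕ :=
  Finset.univ.sup fun i => max (P i).1.1.length (P i).2.1.length

theorem finite_sumLength [Finite A] (n : ℕ) :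
    {P : SemigroupPresentation A k | P.sumLength = n}.Finite :=
  (MonoidPresentation.finite_sumLength (A := A) (k := k) n).preimage toMonoid_injective.injOn

theorem finite_maxLength [Finite A] (n : ℕ) :
    {P : SemigroupPresentation A k | P.maxLength = n}.Finite :=
  (MonoidPresentation.finite_maxLength (A := A) (k := k) n).preimage toMonoid_injective.injOn

/-- The sum length stratification. -/
def sumLengthStratification (A : Type) [Finite A] (k : ℕ) :
    Stratification (SemigroupPresentation A k) :=
  .ofSize sumLength finite_sumLength

/-- The maximum length stratification. -/
def maxLengthStratification (A : Type) [Finite A] (k : ℕ) :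
    Stratification (SemigroupPresentation A k) :=
  .ofSize maxLength finite_maxLength

end SemigroupPresentation

/-!
For a generic presentation of size `n`, no word of length `m = √n` occurs twice as a factor of the
relation words, and every relation word has length at least `20 * m`
(`WordFamily.LengthClass.tendsto_wellSpread`). A repeated factor costs `m` letters, which is too
much for the polynomially many places in which it could be; a family with a very short relation
word can be turned into many families of the same size by lengthening that word. So it suffices to
solve the word problem in linear time under this small overlap condition, called `SmallOverlap`.

Cut each relation word into a left margin `X s` of length `4 * m`, a core `M s` and a right margin
`Z s` of length `4 * m`. The word `u` is parsed from the left: wherever a core occurs together with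
the inner halves of its margins, it is replaced by a marker. The relations act on marked words too:
they replace a marker together with its margins by the other marker of its relation together with
the margins of that one. The point of the overlap condition is that this loses nothing
(`SmallOverlap.reach_iff`): the words equivalent to `u` are those that are obtained by relations
applied to markers that are already there. Indeed a letter of the parse can only change inside the
margins of markers (`SmallOverlap.Inv`), and an occurrence of a relation word whose core is not a
marker, or whose margins run into the core of a neighbouring marker, would show a factor of length
`m` in two different places (`SmallOverlap.occurrence_lift`).

On marked words, relations preserve the positions of the markers, and they only interact through the
letters between two neighbouring markers. Hence whether two marked words are equivalent can be
computed from right to left with finitely many pieces of information, the `SmallOverlap.profile`: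
which markers can be replaced in front of the rest, and which changes of a bounded number of letters
in front of the rest can be completed to an equivalence (`SmallOverlap.profile_cons_congr`, which
rests on `SmallOverlap.hreach_append_iff` for gaps between markers and on
`SmallOverlap.hreach_cut_iff` for long runs of letters).

A machine that reads both words from the left with bounded look-ahead can therefore decide
equivalence: it parses the first word, finds the corresponding symbols of the second one, and keeps
in its state the set of those profiles of the rest that make the whole pair equivalent
(`SmallOverlap.answer_next`). Such a `PairReader` is a Turing machine with four stacks that runs in
linear time (`PairReader.decidableInLinearTime`).
-/

/-! ### Relation words, their margins and their cores -/

/-- A family of words `rel s` with a fixed-point free involution `bar` on the indices, in which no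
word of length `m` has two different occurrences as a factor, while each `rel s` has length at
least `20 * m`. The relations are `rel s = rel (bar s)`. -/
structure SmallOverlap (A S : Type) where
  rel : S → List A
  bar : S → S
  bar_bar : ∀ s, bar (bar s) = s
  bar_ne : ∀ s, bar s ≠ s
  m : ℕ
  m_pos : 0 < m
  long : ∀ s, 20 * m ≤ (rel s).length
  uniq : ∀ s s' a a', a + m ≤ (rel s).length → a' + m ≤ (rel s').length →
    ((rel s).drop a).take m = ((rel s').drop a').take m → s = s' ∧ a = a'

namespace SmallOverlap

variable {A S : Type} (D : SmallOverlap A S)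

/-- The left margin of a relation word. The margins are four times as long as the factors that are
known to be unique, so that unique factors are left when a margin is halved and then shortened at
both ends. -/
def X (s : S) : List A := (D.rel s).take (4 * D.m)

/-- The core of a relation word. -/
def M (s : S) : List A := ((D.rel s).drop (4 * D.m)).take ((D.rel s).length - 8 * D.m)

/-- The right margin of a relation word. -/
def Z (s : S) : List A := (D.rel s).drop ((D.rel s).length - 4 * D.m)

/-- The part of the left margin next to the core. -/
def X₂ (s : S) : List A := (D.X s).drop (2 * D.m)

/-- The part of the right margin next to the core. -/
def Z₁ (s : S) : List A := (D.Z s).take (2 * D.m)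

theorem length_X (s : S) : (D.X s).length = 4 * D.m := by
  have := D.long s
  simp [X]; omega

theorem length_Z (s : S) : (D.Z s).length = 4 * D.m := by
  have := D.long s
  simp [Z]; omega

theorem length_M (s : S) : (D.M s).length = (D.rel s).length - 8 * D.m := by
  have := D.long s
  simp [M]; omega

theorem length_X₂ (s : S) : (D.X₂ s).length = 2 * D.m := by
  simp only [X₂, List.length_drop, length_X]; omega

theorem length_Z₁ (s : S) : (D.Z₁ s).length = 2 * D.m := by
  simp only [Z₁, List.length_take, length_Z]; omega

theorem rel_eq (s : S) : D.rel s = D.X s ++ (D.M s ++ D.Z s) := by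
  have h := D.long s
  have h1 : D.M s ++ D.Z s = (D.rel s).drop (4 * D.m) := by
    have h2 : D.Z s = ((D.rel s).drop (4 * D.m)).drop ((D.rel s).length - 8 * D.m) := by
      rw [Z, List.drop_drop]
      congr 1
      omega
    rw [h2, M, List.take_append_drop]
  rw [h1, X, List.take_append_drop]

theorem length_M_ge (s : S) : 12 * D.m ≤ (D.M s).length := by
  have := D.long s
  rw [length_M]; omega

theorem uniq_append {s s' : S} {α f β α' β' : List A} (hf : D.m ≤ f.length)
    (h : D.rel s = α ++ (f ++ β)) (h' : D.rel s' = α' ++ (f ++ β')) :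
    s = s' ∧ α.length = α'.length := by
  apply D.uniq
  · rw [h]; simp; omega
  · rw [h']; simp; omega
  · rw [h, h']
    simp [List.take_append_of_le_length hf]

theorem X_eq (s : S) : D.X s = (D.X s).take (2 * D.m) ++ D.X₂ s := by
  rw [X₂, List.take_append_drop]

theorem Z_eq (s : S) : D.Z s = D.Z₁ s ++ (D.Z s).drop (2 * D.m) := by
  rw [Z₁, List.take_append_drop]

/-- No word starts with the cores of two different relation words. -/
theorem eq_of_M_prefix {s s' : S} {w : List A} (h : D.M s <+: w) (h' : D.M s' <+: w) : s = s' := by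
  have hm := D.length_M_ge s
  have hm' := D.length_M_ge s'
  have e : (D.M s).take D.m = (D.M s').take D.m := by
    rw [List.prefix_iff_eq_take.1 h, List.prefix_iff_eq_take.1 h', List.take_take, List.take_take]
    congr 1; omega
  refine (D.uniq_append (f := (D.M s).take D.m) (α := D.X s) (α' := D.X s')
    (β := (D.M s).drop D.m ++ D.Z s) (β' := (D.M s').drop D.m ++ D.Z s') ?_ ?_ ?_).1
  · simp; omega
  · rw [← List.append_assoc (List.take _ _), List.take_append_drop, ← rel_eq]
  · rw [e, ← List.append_assoc (List.take _ _), List.take_append_drop, ← rel_eq]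

/-! ### Marked words -/

/-- A letter stands for itself, a marker for the core of its relation word. -/
def expand : A ⊕ S → List A
  | .inl e => [e]
  | .inr s => D.M s

/-- The word that a marked word stands for. -/
def word (κ : List (A ⊕ S)) : List A := κ.flatMap D.expand

@[simp] theorem word_nil : D.word [] = [] := rfl
@[simp] theorem word_append (κ κ' : List (A ⊕ S)) : D.word (κ ++ κ') = D.word κ ++ D.word κ' := by
  simp [word]
@[simp] theorem word_inl (e : A) (κ : List (A ⊕ S)) :
    D.word (.inl e :: κ) = e :: D.word κ := by
  simp [word, expand]
@[simp] theorem word_inr (s : S) (κ : List (A ⊕ S)) :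
    D.word (.inr s :: κ) = D.M s ++ D.word κ := by
  simp [word, expand]
@[simp] theorem word_letters (w : List A) : D.word (w.map .inl) = w := by
  induction w with
  | nil => rfl
  | cons e w ih => simp [ih]

/-- The marked relation word: the core is replaced by its marker. -/
def mrel (s : S) : List (A ⊕ S) := (D.X s).map .inl ++ .inr s :: (D.Z s).map .inl

theorem word_mrel (s : S) : D.word (D.mrel s) = D.rel s := by
  rw [mrel, rel_eq]; simp

theorem length_mrel (s : S) : (D.mrel s).length = 8 * D.m + 1 := by
  simp [mrel, length_X, length_Z]; omega

/-- One application of a relation, to words. -/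
def Step (u v : List A) : Prop :=
  ∃ a b s, u = a ++ (D.rel s ++ b) ∧ v = a ++ (D.rel (D.bar s) ++ b)

/-- One application of a relation, to marked words. -/
def MStep (κ κ' : List (A ⊕ S)) : Prop :=
  ∃ α β s, κ = α ++ (D.mrel s ++ β) ∧ κ' = α ++ (D.mrel (D.bar s) ++ β)

theorem MStep.step {D : SmallOverlap A S} {κ κ' : List (A ⊕ S)} (h : D.MStep κ κ') :
    D.Step (D.word κ) (D.word κ') := by
  obtain ⟨α, β, s, rfl, rfl⟩ := h
  exact ⟨D.word α, D.word β, s, by simp [word_mrel], by simp [word_mrel]⟩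

theorem MStep.symm {D : SmallOverlap A S} {κ κ' : List (A ⊕ S)} (h : D.MStep κ κ') :
    D.MStep κ' κ := by
  obtain ⟨α, β, s, rfl, rfl⟩ := h
  exact ⟨α, β, D.bar s, rfl, by rw [D.bar_bar]⟩

theorem MStep.shape {D : SmallOverlap A S} {κ κ' : List (A ⊕ S)} (h : D.MStep κ κ') :
    κ'.map Sum.isLeft = κ.map Sum.isLeft := by
  obtain ⟨α, β, s, rfl, rfl⟩ := h
  simp [mrel, Function.comp_def, length_X, length_Z]

/-- Equivalence of marked words. -/
def MReach : List (A ⊕ S) → List (A ⊕ S) → Prop := Relation.ReflTransGen D.MStep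

theorem MReach.shape {D : SmallOverlap A S} {κ κ' : List (A ⊕ S)} (h : D.MReach κ κ') :
    κ'.map Sum.isLeft = κ.map Sum.isLeft := by
  induction h with
  | refl => rfl
  | tail _ h ih => rw [h.shape, ih]

theorem MReach.symm {D : SmallOverlap A S} {κ κ' : List (A ⊕ S)} (h : D.MReach κ κ') :
    D.MReach κ' κ := by
  induction h with
  | refl => exact .refl
  | tail _ h ih => exact .head h.symm ih

theorem MReach.reach {D : SmallOverlap A S} {κ κ' : List (A ⊕ S)} (h : D.MReach κ κ') :
    Relation.ReflTransGen D.Step (D.word κ) (D.word κ') := by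
  induction h with
  | refl => exact .refl
  | tail _ h ih => exact .tail ih h.step

/-! ### Parsing a word -/

/-- The part of a relation word by which its occurrences are recognised. -/
def H (s : S) : List A := D.X₂ s ++ (D.M s ++ D.Z₁ s)

theorem rel_eq_H (s : S) :
    D.rel s = (D.X s).take (2 * D.m) ++ (D.H s ++ (D.Z s).drop (2 * D.m)) := by
  rw [rel_eq, H]
  conv_lhs => rw [X_eq, Z_eq]
  simp

/-- `Parse u κ`: scanning `u` from the left, the core of each `H s` that is met is replaced by its
marker, and the scan goes on behind that core. -/
inductive Parse : List A → List (A ⊕ S) → Prop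
  | nil : Parse [] []
  | letter {e : A} {u : List A} {κ : List (A ⊕ S)} (h : ∀ t, ¬ D.H t <+: e :: u)
      (hp : Parse u κ) : Parse (e :: u) (.inl e :: κ)
  | marker {t : S} {u : List A} {κ : List (A ⊕ S)} (hp : Parse (D.Z₁ t ++ u) κ) :
      Parse (D.X₂ t ++ (D.M t ++ (D.Z₁ t ++ u))) ((D.X₂ t).map .inl ++ .inr t :: κ)

theorem Parse.word_eq {D : SmallOverlap A S} {u : List A} {κ : List (A ⊕ S)} (h : D.Parse u κ) :
    D.word κ = u := by
  induction h with
  | nil => rfl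
  | letter _ _ ih => simp [ih]
  | marker _ ih => simp [ih]

theorem exists_parse (u : List A) : ∃ κ, D.Parse u κ := by
  induction hn : u.length using Nat.strong_induction_on generalizing u with
  | _ n ih =>
    subst hn
    by_cases h : ∃ t, D.H t <+: u
    · obtain ⟨t, v, rfl⟩ := h
      obtain ⟨κ, hc⟩ := ih (D.Z₁ t ++ v).length (by
        have := D.m_pos
        simp [H, length_X₂]; omega) _ rfl
      refine ⟨(D.X₂ t).map .inl ++ .inr t :: κ, ?_⟩
      simpa only [H, List.append_assoc] using Parse.marker hc
    · push Not at h
      cases u with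
      | nil => exact ⟨[], .nil⟩
      | cons e u =>
        obtain ⟨κ, hc⟩ := ih u.length (by simp) _ rfl
        exact ⟨_, .letter h hc⟩

theorem H_inj {s t : S} {u : List A} (h : D.H s <+: u) (h' : D.H t <+: u) : s = t := by
  have hm := D.length_X₂ s
  have hm' := D.length_X₂ t
  have hs : D.X₂ s <+: u := (List.prefix_append _ _).trans h
  have ht : D.X₂ t <+: u := (List.prefix_append _ _).trans h'
  have e : D.X₂ s = D.X₂ t := by
    rw [List.prefix_iff_eq_take.1 hs, List.prefix_iff_eq_take.1 ht, hm, hm']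
  have hs' := D.rel_eq_H s
  have ht' := D.rel_eq_H t
  simp only [H, List.append_assoc] at hs' ht'
  rw [← e] at ht'
  exact (D.uniq_append (by omega) hs' ht').1

/-- A suffix of `Z₁ t` is parsed into letters: a marker comes with `2 * D.m` letters in front of
it. -/
theorem Parse.of_letters {D : SmallOverlap A S} {t : S} {z w u : List A} {κ : List (A ⊕ S)}
    (hz : D.Z₁ t = w ++ z) (h : D.Parse (z ++ u) κ) : z.map .inl <+: κ := by
  induction z generalizing w κ with
  | nil => simp
  | cons e z ih =>
    generalize hx : e :: z ++ u = x at h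
    cases h with
    | nil => simp at hx
    | letter h hp =>
      simp only [List.cons_append, List.cons.injEq] at hx
      obtain ⟨rfl, rfl⟩ := hx
      simpa using ih (w := w ++ [e]) (by simp [hz]) hp
    | @marker s v κ' hp =>
      have hl : (e :: z).length ≤ 2 * D.m := by
        rw [← D.length_Z₁ t, hz]; simp
      have h1 : D.X₂ s <+: e :: z ++ u := by rw [hx]; exact List.prefix_append _ _
      have h2 : e :: z <+: D.X₂ s :=
        List.prefix_of_prefix_length_le (List.prefix_append _ _) h1 (by rw [length_X₂]; exact hl)
      exact (h2.map Sum.inl).trans (List.prefix_append _ _)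

/-- In a parse, every marker stands between the inner halves of its margins. -/
theorem Parse.flank {D : SmallOverlap A S} {u : List A} {κ : List (A ⊕ S)} (h : D.Parse u κ)
    {α β : List (A ⊕ S)} {t : S} (hc : κ = α ++ .inr t :: β) :
    (D.X₂ t).map .inl <:+ α ∧ (D.Z₁ t).map .inl <+: β := by
  induction h generalizing α with
  | nil => simp at hc
  | letter _ _ ih =>
    cases α with
    | nil => simp at hc
    | cons a α =>
      simp only [List.cons_append, List.cons.injEq] at hc
      obtain ⟨h1, h2⟩ := ih hc.2
      exact ⟨h1.trans (List.suffix_cons _ _), h2⟩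
  | @marker s v κ' hp ih =>
    rw [List.append_eq_append_iff] at hc
    rcases hc with ⟨γ, rfl, h2⟩ | ⟨γ, h1, h2⟩
    · cases γ with
      | nil =>
        simp only [List.nil_append, List.cons.injEq, Sum.inr.injEq] at h2
        obtain ⟨rfl, rfl⟩ := h2
        exact ⟨by simp, hp.of_letters (w := []) rfl⟩
      | cons a γ =>
        simp only [List.cons_append, List.cons.injEq] at h2
        obtain ⟨h1, h2⟩ := ih h2.2
        exact ⟨h1.trans ⟨(D.X₂ s).map .inl ++ [a], by simp⟩, h2⟩
    · cases γ with
      | nil =>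
        simp only [List.nil_append, List.cons.injEq, Sum.inr.injEq] at h2
        obtain ⟨rfl, rfl⟩ := h2
        simp only [List.append_nil] at h1
        exact ⟨by simp [h1], hp.of_letters (w := []) rfl⟩
      | cons a γ =>
        simp only [List.cons_append, List.cons.injEq] at h2
        have : Sum.inr t ∈ (D.X₂ s).map (Sum.inl : A → A ⊕ S) := by
          rw [h1, ← h2.1]; simp
        simp at this

/-- A parse has overlooked nothing that it should have marked. -/
theorem Parse.no_H {D : SmallOverlap A S} {u : List A} {κ : List (A ⊕ S)} (h : D.Parse u κ)
    {α β : List (A ⊕ S)} {s : S} (hc : κ = α ++ ((D.H s).map .inl ++ β)) : False := by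
  have hm := D.m_pos
  have hlen : 14 * D.m ≤ (D.H s).length := by
    have := D.length_M_ge s
    simp [H, length_X₂, length_Z₁]; omega
  induction h generalizing α with
  | nil =>
    have := congrArg List.length hc
    simp at this; omega
  | @letter e u κ hn hp ih =>
    cases α with
    | nil =>
      apply hn s
      have := congrArg D.word hc
      rw [(Parse.letter hn hp).word_eq] at this
      rw [this]; simp
    | cons a α =>
      simp only [List.cons_append, List.cons.injEq] at hc
      exact ih hc.2
  | @marker t v κ' hp ih =>
    rw [List.append_eq_append_iff] at hc
    rcases hc with ⟨γ, rfl, h2⟩ | ⟨γ, h1, h2⟩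
    · cases γ with
      | nil =>
        have := congrArg List.head? h2
        cases hH : D.H s with
        | nil => rw [hH] at hlen; simp at hlen; omega
        | cons a l => simp [hH] at this
      | cons a γ =>
        simp only [List.cons_append, List.cons.injEq] at h2
        exact ih h2.2
    · -- the marker would lie among the letters of `H s`
      have hγ : γ.length ≤ 2 * D.m := by
        have := congrArg List.length h1
        simp [length_X₂] at this; omega
      have h3 : ((D.H s).map Sum.inl ++ β)[γ.length]? = (γ ++ Sum.inr t :: κ')[γ.length]? := by
        rw [h2]
      rw [List.getElem?_append_left (by simp; omega)] at h3
      simp at h3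

/-! ### How far a marked word can move -/

/-- There is a marker at position `n`. -/
def IsMark (κ : List (A ⊕ S)) (n : ℕ) : Prop := ∃ t, κ[n]? = some (.inr t)

theorem not_isMark_of_map {κ : List (A ⊕ S)} {n : ℕ} {o : Option A} (h : κ[n]? = o.map .inl) :
    ¬ IsMark κ n := by
  rintro ⟨t, ht⟩
  rw [h] at ht
  cases o <;> simp at ht

theorem isMark_of_shape {κ κ' : List (A ⊕ S)} (h : κ'.map Sum.isLeft = κ.map Sum.isLeft) {n : ℕ}
    (hn : IsMark κ n) : IsMark κ' n := by
  obtain ⟨t, ht⟩ := hn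
  have h1 := congrArg (fun l => l[n]?) h
  simp only [List.getElem?_map, ht] at h1
  cases h2 : κ'[n]? with
  | none => simp [h2] at h1
  | some x =>
    cases x with
    | inl e => simp [h2] at h1
    | inr s => exact ⟨s, h2⟩

theorem isMark_iff_of_shape {κ κ' : List (A ⊕ S)} (h : κ'.map Sum.isLeft = κ.map Sum.isLeft)
    {n : ℕ} : IsMark κ' n ↔ IsMark κ n :=
  ⟨isMark_of_shape h.symm, isMark_of_shape h⟩

/-- The marker at position `n` is followed by the right margin of its relation word. -/
def RH (κ : List (A ⊕ S)) (n : ℕ) : Prop :=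
  ∃ t, κ[n]? = some (.inr t) ∧ ∀ i < 4 * D.m, κ[n + 1 + i]? = ((D.Z t)[i]?).map .inl

/-- The marker at position `n` is preceded by the left margin of its relation word. -/
def LH (κ : List (A ⊕ S)) (n : ℕ) : Prop :=
  ∃ t, κ[n]? = some (.inr t) ∧ 4 * D.m ≤ n ∧
    ∀ i < 4 * D.m, κ[n - 4 * D.m + i]? = ((D.X t)[i]?).map .inl

/-- What a marked word `κ` that is equivalent to `κ₀` looks like: the markers are in the same
positions, and a letter can differ from the letter of `κ₀` only if it lies in a complete margin of
the next marker on one of the sides, or between two neighbouring markers that are so close to each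
other that their margins overlap. -/
def Inv (κ₀ κ : List (A ⊕ S)) : Prop :=
  κ.map Sum.isLeft = κ₀.map Sum.isLeft ∧ ∀ j, κ[j]? = κ₀[j]? ∨ IsMark κ j ∨
    (∃ n, D.RH κ n ∧ n < j ∧ j ≤ n + 4 * D.m) ∨ (∃ n, D.LH κ n ∧ j < n ∧ n ≤ j + 4 * D.m) ∨
    ∃ n₁ n₂, n₁ < j ∧ j < n₂ ∧ IsMark κ n₁ ∧ IsMark κ n₂ ∧ n₁ + 4 * D.m < n₂ ∧
      n₂ ≤ n₁ + 8 * D.m ∧ ∀ i, n₁ < i → i < n₂ → ¬ IsMark κ i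

theorem inv_refl (κ : List (A ⊕ S)) : D.Inv κ κ := ⟨rfl, fun _ => .inl rfl⟩

theorem getElem?_mrel_mid (α β : List (A ⊕ S)) (s : S) :
    (α ++ (D.mrel s ++ β))[α.length + 4 * D.m]? = some (.inr s) := by
  rw [List.getElem?_append_right (by omega), mrel,
    List.append_assoc, List.getElem?_append_right (by simp [length_X])]
  simp [length_X]

theorem getElem?_mrel_left (α β : List (A ⊕ S)) (s : S) {i : ℕ} (hi : i < 4 * D.m) :
    (α ++ (D.mrel s ++ β))[α.length + i]? = ((D.X s)[i]?).map .inl := by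
  rw [List.getElem?_append_right (by omega), mrel,
    List.append_assoc, List.getElem?_append_left (by simp [length_X]; omega)]
  simp

theorem getElem?_mrel_right (α β : List (A ⊕ S)) (s : S) {i : ℕ} (hi : i < 4 * D.m) :
    (α ++ (D.mrel s ++ β))[α.length + 4 * D.m + 1 + i]? = ((D.Z s)[i]?).map .inl := by
  rw [List.getElem?_append_right (by omega), mrel,
    List.append_assoc, List.getElem?_append_right (by simp [length_X]; omega)]
  have : α.length + 4 * D.m + 1 + i - α.length - ((D.X s).map (Sum.inl : A → A ⊕ S)).length
      = i + 1 := by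
    simp [length_X]; omega
  rw [this, List.cons_append, List.getElem?_cons_succ,
    List.getElem?_append_left (by simp [length_Z]; omega)]
  simp

theorem getElem?_mrel_out (α β : List (A ⊕ S)) (s s' : S) {j : ℕ}
    (hj : j < α.length ∨ α.length + 8 * D.m < j) :
    (α ++ (D.mrel s ++ β))[j]? = (α ++ (D.mrel s' ++ β))[j]? := by
  rcases hj with hj | hj
  · rw [List.getElem?_append_left hj, List.getElem?_append_left hj]
  · have h1 := D.length_mrel s
    have h2 := D.length_mrel s'
    rw [List.getElem?_append_right (by omega), List.getElem?_append_right (by omega),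
      List.getElem?_append_right (by omega), List.getElem?_append_right (by omega), h1, h2]

theorem isMark_mrel (α β : List (A ⊕ S)) (s : S) {j : ℕ} (h : IsMark (α ++ (D.mrel s ++ β)) j)
    (h1 : α.length ≤ j) (h2 : j ≤ α.length + 8 * D.m) : j = α.length + 4 * D.m := by
  rcases lt_trichotomy j (α.length + 4 * D.m) with h3 | h3 | h3
  · have := D.getElem?_mrel_left α β s (i := j - α.length) (by omega)
    rw [show α.length + (j - α.length) = j by omega] at this
    exact (not_isMark_of_map this h).elim
  · exact h3
  · have := D.getElem?_mrel_right α β s (i := j - (α.length + 4 * D.m + 1)) (by omega)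
    rw [show α.length + 4 * D.m + 1 + (j - (α.length + 4 * D.m + 1)) = j by omega] at this
    exact (not_isMark_of_map this h).elim

theorem RH.isMark {D : SmallOverlap A S} {κ : List (A ⊕ S)} {n : ℕ} (h : D.RH κ n) :
    IsMark κ n := let ⟨t, ht, _⟩ := h; ⟨t, ht⟩

theorem LH.isMark {D : SmallOverlap A S} {κ : List (A ⊕ S)} {n : ℕ} (h : D.LH κ n) :
    IsMark κ n := let ⟨t, ht, _⟩ := h; ⟨t, ht⟩

theorem RH.not_isMark {D : SmallOverlap A S} {κ : List (A ⊕ S)} {n i : ℕ} (h : D.RH κ n)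
    (h1 : n < i) (h2 : i ≤ n + 4 * D.m) : ¬ IsMark κ i := by
  obtain ⟨t, -, ht⟩ := h
  have := ht (i - (n + 1)) (by omega)
  rw [show n + 1 + (i - (n + 1)) = i by omega] at this
  exact not_isMark_of_map this

theorem LH.not_isMark {D : SmallOverlap A S} {κ : List (A ⊕ S)} {n i : ℕ} (h : D.LH κ n)
    (h1 : i < n) (h2 : n ≤ i + 4 * D.m) : ¬ IsMark κ i := by
  obtain ⟨t, -, hn, ht⟩ := h
  have := ht (i + 4 * D.m - n) (by omega)
  rw [show n - 4 * D.m + (i + 4 * D.m - n) = i by omega] at this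
  exact not_isMark_of_map this

theorem Inv.step {D : SmallOverlap A S} {κ₀ κ κ' : List (A ⊕ S)} (h : D.Inv κ₀ κ)
    (hs : D.MStep κ κ') : D.Inv κ₀ κ' := by
  have hm := D.m_pos
  have hsh := hs.shape
  have hmk : ∀ {j}, IsMark κ' j ↔ IsMark κ j := isMark_iff_of_shape hsh
  refine ⟨hsh.trans h.1, fun j => ?_⟩
  obtain ⟨α, β, s, hc, hc'⟩ := hs
  set a := α.length with ha
  have hout : ∀ {j}, j < a ∨ a + 8 * D.m < j → κ'[j]? = κ[j]? := fun hj => by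
    rw [hc, hc']; exact D.getElem?_mrel_out _ _ _ _ hj
  have hin : ∀ {j}, IsMark κ j → a ≤ j → j ≤ a + 8 * D.m → j = a + 4 * D.m := fun hj h1 h2 => by
    rw [hc] at hj; exact D.isMark_mrel _ _ _ hj h1 h2
  have hR : D.RH κ' (a + 4 * D.m) := by
    rw [hc']
    exact ⟨_, D.getElem?_mrel_mid _ _ _, fun i hi => D.getElem?_mrel_right _ _ _ hi⟩
  have hL : D.LH κ' (a + 4 * D.m) := by
    rw [hc']
    refine ⟨_, D.getElem?_mrel_mid _ _ _, by omega, fun i hi => ?_⟩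
    rw [Nat.add_sub_cancel]
    exact D.getElem?_mrel_left _ _ _ hi
  by_cases h1 : j < a ∨ a + 8 * D.m < j
  · rcases h.2 j with h2 | h2 | ⟨n, hn, h2, h3⟩ | ⟨n, hn, h2, h3⟩ | ⟨n₁, n₂, h2, h3, h4, h5, h6⟩
    · exact .inl ((hout h1).trans h2)
    · exact .inr (.inl (hmk.2 h2))
    · -- the margin of the marker at `n` survives unless the rewritten word overlaps with it
      have e1 : n < a ∨ a + 8 * D.m < n := by
        by_contra h0
        have := hin hn.isMark (by omega) (by omega)
        omega
      by_cases e2 : a ≤ n + 4 * D.m ∧ n < a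
      · refine .inr (.inr (.inr (.inr ⟨n, a + 4 * D.m, h2, ?_, hmk.2 hn.isMark, hR.isMark,
          by omega, by omega, fun i h4 h5 => ?_⟩)))
        · rcases h1 with h1 | h1 <;> omega
        · by_cases h6 : i ≤ n + 4 * D.m
          · rw [hmk]; exact hn.not_isMark h4 h6
          · exact hL.not_isMark h5 (by omega)
      · obtain ⟨t, ht, ht'⟩ := hn
        refine .inr (.inr (.inl ⟨n, ⟨t, (hout e1).trans ht, fun i hi => ?_⟩, h2, h3⟩))
        rw [hout (by omega), ht' i hi]
    · have e1 : n < a ∨ a + 8 * D.m < n := by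
        by_contra h0
        have := hin hn.isMark (by omega) (by omega)
        omega
      have e0 : 4 * D.m ≤ n := hn.choose_spec.2.1
      by_cases e2 : n ≤ a + 12 * D.m ∧ a < n
      · refine .inr (.inr (.inr (.inr ⟨a + 4 * D.m, n, ?_, h2, hR.isMark, hmk.2 hn.isMark,
          by omega, by omega, fun i h4 h5 => ?_⟩)))
        · rcases h1 with h1 | h1 <;> omega
        · by_cases h6 : n ≤ i + 4 * D.m
          · rw [hmk]; exact hn.not_isMark h5 h6
          · exact hR.not_isMark h4 (by omega)
      · obtain ⟨t, ht, _, ht'⟩ := hn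
        refine .inr (.inr (.inr (.inl ⟨n, ⟨t, (hout e1).trans ht, e0, fun i hi => ?_⟩, h2, h3⟩)))
        rw [hout (by omega), ht' i hi]
    · exact .inr (.inr (.inr (.inr ⟨n₁, n₂, h2, h3, hmk.2 h4, hmk.2 h5,
        h6.1, h6.2.1, fun i h7 h8 => mt hmk.1 (h6.2.2 i h7 h8)⟩)))
  · rcases lt_trichotomy j (a + 4 * D.m) with h2 | rfl | h2
    · exact .inr (.inr (.inr (.inl ⟨_, hL, h2, by omega⟩)))
    · exact .inr (.inl hR.isMark)
    · exact .inr (.inr (.inl ⟨_, hR, h2, by omega⟩))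

theorem MReach.inv {D : SmallOverlap A S} {κ κ' : List (A ⊕ S)} (h : D.MReach κ κ') :
    D.Inv κ κ' := by
  induction h with
  | refl => exact D.inv_refl κ
  | tail _ h ih => exact ih.step h

/-! ### Occurrences of relation words -/

theorem uniq_getElem? {s s' : S} {a a' : ℕ} (h : a + D.m ≤ (D.rel s).length)
    (h' : a' + D.m ≤ (D.rel s').length)
    (e : ∀ k < D.m, (D.rel s)[a + k]? = (D.rel s')[a' + k]?) : s = s' ∧ a = a' := by
  refine D.uniq s s' a a' h h' (List.ext_getElem? fun k => ?_)
  rw [List.getElem?_take, List.getElem?_take]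
  split_ifs with hk
  · rw [List.getElem?_drop, List.getElem?_drop, e k hk]
  · rfl

theorem X_getElem? (s : S) {i : ℕ} (hi : i < 4 * D.m) : (D.X s)[i]? = (D.rel s)[i]? := by
  rw [X, List.getElem?_take_of_lt hi]

theorem Z_getElem? (s : S) (i : ℕ) :
    (D.Z s)[i]? = (D.rel s)[(D.rel s).length - 4 * D.m + i]? := by
  rw [Z, List.getElem?_drop]

theorem eq_append_of_getElem? {α : Type*} {l w : List α} {n : ℕ}
    (h : ∀ i < w.length, l[n + i]? = w[i]?) : l = l.take n ++ (w ++ l.drop (n + w.length)) := by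
  have : w ++ l.drop (n + w.length) = l.drop n := by
    refine List.ext_getElem? fun i => ?_
    rw [List.getElem?_drop, List.getElem?_append]
    split_ifs with hi
    · exact (h i hi).symm
    · rw [List.getElem?_drop]; congr 1; omega
  rw [this, List.take_append_drop]

theorem map_inl_inj {o o' : Option A} (h : o.map (Sum.inl : A → A ⊕ S) = o'.map Sum.inl) : o = o' :=
  Option.map_injective Sum.inl_injective h

theorem Parse.flank_right {D : SmallOverlap A S} {u : List A} {κ : List (A ⊕ S)}
    (h : D.Parse u κ) {n : ℕ} {t : S} (hn : κ[n]? = some (.inr t)) {i : ℕ} (hi : i < 2 * D.m) :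
    κ[n + 1 + i]? = ((D.Z t)[i]?).map .inl := by
  have h1 : κ = κ.take n ++ .inr t :: κ.drop (n + 1) :=
    eq_append_of_getElem? (w := [Sum.inr t]) (by simpa using hn)
  obtain ⟨-, γ, hγ⟩ := h.flank h1
  have h2 := congrArg (fun l : List (A ⊕ S) => l[i]?) hγ
  simp only [List.getElem?_drop] at h2
  rw [← h2, List.getElem?_append_left (by simp [length_Z₁]; omega), List.getElem?_map, Z₁,
    List.getElem?_take_of_lt hi]

theorem Parse.flank_left {D : SmallOverlap A S} {u : List A} {κ : List (A ⊕ S)}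
    (h : D.Parse u κ) {n : ℕ} {t : S} (hn : κ[n]? = some (.inr t)) :
    2 * D.m ≤ n ∧ ∀ i < 2 * D.m, κ[n - 2 * D.m + i]? = ((D.X t)[2 * D.m + i]?).map .inl := by
  have h1 : κ = κ.take n ++ .inr t :: κ.drop (n + 1) :=
    eq_append_of_getElem? (w := [Sum.inr t]) (by simpa using hn)
  obtain ⟨⟨γ, hγ⟩, -⟩ := h.flank h1
  have hlt : n < κ.length := (List.getElem?_eq_some_iff.1 hn).1
  have h2 := congrArg List.length hγ
  simp only [List.length_append, List.length_map, length_X₂, List.length_take] at h2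
  refine ⟨by omega, fun i hi => ?_⟩
  have h3 := congrArg (fun l : List (A ⊕ S) => l[n - 2 * D.m + i]?) hγ
  rw [List.getElem?_take_of_lt (by omega), List.getElem?_append_right (by omega)] at h3
  rw [← h3, show n - 2 * D.m + i - γ.length = i by omega, List.getElem?_map, X₂,
    List.getElem?_drop]

/-- Nothing happens between two markers that are at most one margin apart. -/
theorem Inv.between {D : SmallOverlap A S} {κ₀ κ : List (A ⊕ S)} (h : D.Inv κ₀ κ) {n n' j : ℕ}
    (hn : IsMark κ n) (hn' : IsMark κ n') (hj : n < j) (hj' : j < n') (hle : n' ≤ n + 4 * D.m)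
    (hb : ∀ i, n < i → i < n' → ¬ IsMark κ i) : κ[j]? = κ₀[j]? := by
  rcases h.2 j with h2 | h2 | ⟨p, hp, h2, h3⟩ | ⟨p, hp, h2, h3⟩ | ⟨n₁, n₂, h2, h3, h4, h5, h6, h7, h8⟩
  · exact h2
  · exact (hb j hj hj' h2).elim
  · rcases lt_trichotomy p n with h4 | rfl | h4
    · exact (hp.not_isMark h4 (by omega) hn).elim
    · exact (hp.not_isMark (by omega) hle hn').elim
    · exact (hb p h4 (by omega) hp.isMark).elim
  · rcases lt_trichotomy p n' with h4 | rfl | h4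
    · exact (hb p (by omega) h4 hp.isMark).elim
    · exact (hp.not_isMark (by omega) hle hn).elim
    · exact (hp.not_isMark h4 (by omega) hn').elim
  · rcases lt_trichotomy n₁ n with h9 | rfl | h9
    · exact (h8 n h9 (by omega) hn).elim
    · by_cases h10 : n' < n₂
      · exact (h8 n' (by omega) h10 hn').elim
      · omega
    · exact (hb n₁ h9 (by omega) h4).elim

theorem getElem?_block (α δ : List (A ⊕ S)) (y : List A) {i : ℕ} (hi : i < y.length) :
    (α ++ (y.map .inl ++ δ))[α.length + i]? = (y[i]?).map .inl := by
  rw [List.getElem?_append_right (by omega), List.getElem?_append_left (by simp; omega)]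
  simp

theorem not_isMark_block (α δ : List (A ⊕ S)) (y : List A) {j : ℕ} (h1 : α.length ≤ j)
    (h2 : j < α.length + y.length) : ¬ IsMark (α ++ (y.map .inl ++ δ)) j := by
  have := getElem?_block α δ y (i := j - α.length) (by omega)
  rw [show α.length + (j - α.length) = j by omega] at this
  exact not_isMark_of_map this

/-- A relation word whose core is the marker `s` cannot start inside the core of the marker `t` in
front of it: the letters between such close markers are those of the parse, where they are the
beginning of the right margin of a relation word, and they also belong to the left margin of `s`. -/
theorem no_marker_in_left_margin {D : SmallOverlap A S} {u : List A} {κ₀ : List (A ⊕ S)}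
    (hp : D.Parse u κ₀) {α δ : List (A ⊕ S)} {t s : S} {q y : List A}
    (hi : D.Inv κ₀ (α ++ .inr t :: (y.map .inl ++ .inr s :: δ)))
    (hX : D.X s = q ++ y) (hq : q ≠ []) (hq' : q.length < D.m) : False := by
  have hq0 : 0 < q.length := List.length_pos_iff.2 hq
  have hl := congrArg List.length hX
  have hlong := D.long s
  rw [length_X, List.length_append] at hl
  have e1 : α ++ Sum.inr t :: (y.map .inl ++ Sum.inr s :: δ)
      = (α ++ [.inr t]) ++ (y.map .inl ++ Sum.inr s :: δ) := by simp
  have hn : IsMark (α ++ Sum.inr t :: (y.map .inl ++ Sum.inr s :: δ)) α.length :=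
    ⟨t, by simp⟩
  have hn' : IsMark (α ++ Sum.inr t :: (y.map .inl ++ Sum.inr s :: δ)) (α.length + 1 + y.length) :=
    ⟨s, by rw [e1, List.getElem?_append_right (by simp),
      List.getElem?_append_right (by simp)]; simp⟩
  obtain ⟨t₀, ht₀⟩ := (isMark_iff_of_shape hi.1).1 hn
  have hlong' := D.long t₀
  have := D.uniq_getElem? (s := s) (s' := t₀) (a := q.length)
    (a' := (D.rel t₀).length - 4 * D.m) (by omega) (by omega) fun k hk => by
    rw [← D.Z_getElem?, ← D.X_getElem? _ (by omega), hX, List.getElem?_append_right (by omega),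
      Nat.add_sub_cancel_left]
    apply map_inl_inj (S := S)
    rw [← hp.flank_right ht₀ (by omega), ← hi.between hn hn' (by omega) (by omega) (by omega)]
    · rw [e1, show α.length + 1 + k = (α ++ [Sum.inr t]).length + k by simp,
        getElem?_block _ _ _ (by omega)]
    · intro i h1 h2
      rw [e1]
      exact not_isMark_block _ _ _ (by simp; omega) (by simp; omega)
  omega

/-- A relation word whose core is the marker `s` cannot end inside the core of the marker `t` behind
it, for the same reason as in `no_marker_in_left_margin`. -/
theorem no_marker_in_right_margin {D : SmallOverlap A S} {u : List A} {κ₀ : List (A ⊕ S)}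
    (hp : D.Parse u κ₀) {α δ : List (A ⊕ S)} {t s : S} {q y : List A}
    (hi : D.Inv κ₀ (α ++ .inr s :: (y.map .inl ++ .inr t :: δ)))
    (hZ : D.Z s = y ++ q) (hq : q ≠ []) (hq' : q.length < D.m) : False := by
  have hq0 : 0 < q.length := List.length_pos_iff.2 hq
  have hl := congrArg List.length hZ
  have hlong := D.long s
  rw [length_Z, List.length_append] at hl
  have e1 : α ++ Sum.inr s :: (y.map .inl ++ Sum.inr t :: δ)
      = (α ++ [.inr s]) ++ (y.map .inl ++ Sum.inr t :: δ) := by simp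
  have hn : IsMark (α ++ Sum.inr s :: (y.map .inl ++ Sum.inr t :: δ)) α.length :=
    ⟨s, by simp⟩
  have hn' : IsMark (α ++ Sum.inr s :: (y.map .inl ++ Sum.inr t :: δ)) (α.length + 1 + y.length) :=
    ⟨t, by rw [e1, List.getElem?_append_right (by simp),
      List.getElem?_append_right (by simp)]; simp⟩
  obtain ⟨t₀, ht₀⟩ := (isMark_iff_of_shape hi.1).1 hn'
  have hlong' := D.long t₀
  obtain ⟨hle, hfl⟩ := hp.flank_left ht₀
  have := D.uniq_getElem? (s := s) (s' := t₀) (a := (D.rel s).length - 4 * D.m + (y.length - D.m))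
    (a' := 3 * D.m) (by omega) (by omega) fun k hk => by
    rw [add_assoc ((D.rel s).length - 4 * D.m), ← D.Z_getElem?, ← D.X_getElem? _ (by omega), hZ,
      List.getElem?_append_left (by omega)]
    apply map_inl_inj (S := S)
    have h1 := hfl (D.m + k) (by omega)
    rw [show 2 * D.m + (D.m + k) = 3 * D.m + k by omega] at h1
    rw [← h1, ← hi.between hn hn' (by omega) (by omega) (by omega)]
    · rw [e1, show α.length + 1 + y.length - 2 * D.m + (D.m + k)
        = (α ++ [Sum.inr s]).length + (y.length - D.m + k) by simp; omega,
        getElem?_block _ _ _ (by omega)]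
    · intro i h1 h2
      rw [e1]
      exact not_isMark_block _ _ _ (by simp; omega) (by simp; omega)
  omega

/-- No relation word is spelled out by letters, even up to short pieces at its ends: all letters but
those close to the ends would be letters of the parse, which would have put a marker there. -/
theorem no_letter_occurrence {D : SmallOverlap A S} {u : List A} {κ₀ : List (A ⊕ S)}
    (hp : D.Parse u κ₀) {α δ : List (A ⊕ S)} {s : S} {q y q' : List A}
    (hi : D.Inv κ₀ (α ++ (y.map .inl ++ δ)))
    (hs : D.rel s = q ++ (y ++ q')) (hq : q.length < D.m) (hq' : q'.length < D.m) : False := by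
  have hl := congrArg List.length hs
  have hlong := D.long s
  simp only [List.length_append] at hl
  have hrel : ∀ {i}, i < y.length → (D.rel s)[q.length + i]? = y[i]? := fun {i} h => by
    rw [hs, List.getElem?_append_right (by omega), List.getElem?_append_left (by omega)]
    congr 1; omega
  -- the letters that are not close to the ends are the same as in the original word
  have key : ∀ i, D.m ≤ i → i + D.m < y.length → κ₀[α.length + i]? = (y[i]?).map .inl := by
    intro i h1 h2
    have hb : ∀ {j}, IsMark (α ++ (y.map .inl ++ δ)) j → j < α.length ∨ α.length + y.length ≤ j :=
      fun {j} hj => by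
        by_contra h0
        exact not_isMark_block α δ y (by omega) (by omega) hj
    rw [← getElem?_block α δ y (by omega)]
    rcases hi.2 (α.length + i) with h3 | h3 | ⟨p, hp, h3, h4⟩ | ⟨p, hp, h3, h4⟩ |
      ⟨n₁, n₂, h3, h4, h5, h6, h7, h8, h9⟩
    · exact h3.symm
    · have := hb h3
      omega
    · have h5 := hb hp.isMark
      obtain ⟨t, -, ht⟩ := hp
      have hlong' := D.long t
      have := D.uniq_getElem? (s := s) (s' := t) (a := q.length)
        (a' := (D.rel t).length - 4 * D.m + (α.length - (p + 1))) (by omega) (by omega)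
        fun k hk => by
          rw [add_assoc ((D.rel t).length - 4 * D.m), ← D.Z_getElem?, hrel (by omega)]
          apply map_inl_inj (S := S)
          rw [← getElem?_block α δ y (by omega), ← ht _ (by omega)]
          congr 1; omega
      omega
    · have h5 := hb hp.isMark
      obtain ⟨t, -, hle, ht⟩ := hp
      have hlong' := D.long t
      have := D.uniq_getElem? (s := s) (s' := t) (a := q.length + (y.length - D.m))
        (a' := α.length + y.length - D.m - (p - 4 * D.m)) (by omega) (by omega)
        fun k hk => by
          rw [add_assoc q.length, hrel (by omega), ← D.X_getElem? _ (by omega)]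
          apply map_inl_inj (S := S)
          rw [← getElem?_block α δ y (by omega), ← ht _ (by omega)]
          congr 1; omega
      omega
    · have := hb h5
      have := hb h6
      omega
  have hH := D.rel_eq_H s
  have hlH := congrArg List.length hH
  simp only [List.length_append, List.length_take, List.length_drop, length_X, length_Z] at hlH
  have := D.m_pos
  refine hp.no_H (s := s) (eq_append_of_getElem? (n := α.length + (2 * D.m - q.length))
    (w := (D.H s).map Sum.inl) fun i h => ?_)
  simp only [List.length_map] at h
  rw [add_assoc α.length, key _ (by omega) (by omega), ← hrel (by omega), hH,
    List.getElem?_append_right (by simp [length_X]; omega),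
    List.getElem?_append_left (by simp [length_X]; omega), List.getElem?_map]
  congr 2
  simp [length_X]; omega

/-- Cutting the word of a marked word cuts the marked word, either between two symbols or inside
the core of a marker. -/
theorem word_eq_append {κ : List (A ⊕ S)} {a b : List A} (h : D.word κ = a ++ b) :
    (∃ α β, κ = α ++ β ∧ D.word α = a ∧ D.word β = b) ∨
    ∃ α t β p q, κ = α ++ .inr t :: β ∧ D.M t = p ++ q ∧ p ≠ [] ∧ q ≠ [] ∧ a = D.word α ++ p ∧
      b = q ++ D.word β := by
  induction κ generalizing a with
  | nil =>
    simp only [word_nil, List.nil_eq, List.append_eq_nil_iff] at h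
    exact .inl ⟨[], [], rfl, h.1.symm, h.2.symm⟩
  | cons x κ ih =>
    by_cases ha : a = []
    · subst ha
      exact .inl ⟨[], x :: κ, rfl, rfl, by simpa using h⟩
    · have step : ∀ a', D.expand x ++ a' = a → D.word κ = a' ++ b →
          (∃ α β, x :: κ = α ++ β ∧ D.word α = a ∧ D.word β = b) ∨
          ∃ α t β p q, x :: κ = α ++ .inr t :: β ∧ D.M t = p ++ q ∧ p ≠ [] ∧ q ≠ [] ∧
            a = D.word α ++ p ∧ b = q ++ D.word β := fun a' h1 h2 => by
        rcases ih h2 with ⟨α, β, rfl, rfl, rfl⟩ | ⟨α, t, β, p, q, rfl, h3, h4, h5, rfl, rfl⟩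
        · exact Or.inl ⟨x :: α, β, rfl, by rw [← h1]; simp [word], rfl⟩
        · exact Or.inr ⟨x :: α, t, β, p, q, rfl, h3, h4, h5, by rw [← h1]; simp [word], rfl⟩
      have h' : D.expand x ++ D.word κ = a ++ b := by rw [← h]; simp [word]
      rcases List.append_eq_append_iff.1 h' with ⟨a', h1, h2⟩ | ⟨q, h1, h2⟩
      · exact step a' h1.symm h2
      · by_cases hq : q = []
        · subst hq
          exact step [] (by simpa using h1) (by simpa using h2.symm)
        · cases x with
          | inl e =>
            have := congrArg List.length h1
            have := List.length_pos_iff.2 ha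
            have := List.length_pos_iff.2 hq
            simp [expand] at *
            omega
          | inr t => exact .inr ⟨[], t, κ, a, q, rfl, h1, ha, hq, rfl, h2⟩

theorem exists_letters_or_marker (γ : List (A ⊕ S)) :
    (∃ y : List A, γ = y.map .inl) ∨ ∃ (y : List A) (t : S) (γ' : List (A ⊕ S)),
      γ = y.map .inl ++ .inr t :: γ' := by
  induction γ with
  | nil => exact .inl ⟨[], rfl⟩
  | cons x γ ih =>
    cases x with
    | inr t => exact .inr ⟨[], t, γ, rfl⟩
    | inl e =>
      rcases ih with ⟨y, rfl⟩ | ⟨y, t, γ', rfl⟩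
      · exact .inl ⟨e :: y, rfl⟩
      · exact .inr ⟨e :: y, t, γ', rfl⟩

theorem letters_of_short {γ : List (A ⊕ S)} (h : (D.word γ).length < 12 * D.m) :
    γ = (D.word γ).map .inl := by
  rcases exists_letters_or_marker γ with ⟨y, rfl⟩ | ⟨y, t, γ', rfl⟩
  · simp
  · have := D.length_M_ge t
    simp at h
    omega

/-- An occurrence of a relation word, cut out of a marked word: the marked word `γ` stands for the
relation word without the pieces `q` and `q'`, shorter than `D.m`, that lie inside the cores of the
neighbouring markers. -/
theorem occurrence_cut {κ : List (A ⊕ S)} {a b : List A} {s : S}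
    (h : D.word κ = a ++ (D.rel s ++ b)) :
    ∃ α q γ q' β, κ = α ++ (γ ++ β) ∧ D.rel s = q ++ (D.word γ ++ q') ∧
      q.length < D.m ∧ q'.length < D.m ∧
      (q = [] ∧ D.word α = a ∨ q ≠ [] ∧ ∃ α' t, α = α' ++ [.inr t]) ∧
      (q' = [] ∧ D.word β = b ∨ q' ≠ [] ∧ ∃ t β', β = .inr t :: β') := by
  have hlong := D.long s
  have hm := D.m_pos
  obtain ⟨α, q, ρ, β₀, rfl, hs, hq, hβ, hα⟩ : ∃ α q ρ β₀, κ = α ++ β₀ ∧ D.rel s = q ++ ρ ∧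
      q.length < D.m ∧ D.word β₀ = ρ ++ b ∧
      (q = [] ∧ D.word α = a ∨ q ≠ [] ∧ ∃ α' t, α = α' ++ [.inr t]) := by
    rcases D.word_eq_append h with ⟨α, β, rfl, h1, h2⟩ | ⟨α, t, β, p, q, rfl, h1, h2, h3, h4, h5⟩
    · exact ⟨α, [], D.rel s, β, rfl, rfl, hm, h2, .inl ⟨rfl, h1⟩⟩
    · have hq : q.length < D.m := by
        by_contra h0
        -- otherwise a factor of length `m` of the core of `t` is a prefix of the relation word
        have e : q.take D.m = (D.rel s).take D.m := by
          have := congrArg (List.take D.m) h5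
          rw [List.take_append_of_le_length (by omega),
            List.take_append_of_le_length (by omega)] at this
          exact this.symm
        have hl : (q.take D.m).length = D.m := by simp; omega
        have := D.uniq_append (s := s) (s' := t) (α := []) (α' := D.X t ++ p) (f := q.take D.m)
          (β := (D.rel s).drop D.m) (β' := q.drop D.m ++ D.Z t) (by omega)
          (by rw [e]; simp)
          (by rw [rel_eq, h1, ← List.append_assoc (List.take _ _), List.take_append_drop]; simp)
        have h6 := this.2
        simp [length_X] at h6
        omega
      have hpre : q <+: D.rel s :=
        List.prefix_of_prefix_length_le (h5 ▸ List.prefix_append _ _) (List.prefix_append _ b)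
          (by omega)
      obtain ⟨ρ, hρ⟩ := hpre
      refine ⟨α ++ [.inr t], q, ρ, β, by simp, hρ.symm, hq, ?_, .inr ⟨h3, α, t, rfl⟩⟩
      rw [← hρ, List.append_assoc] at h5
      exact (List.append_cancel_left h5).symm
  have hsl := congrArg List.length hs
  simp only [List.length_append] at hsl
  rcases D.word_eq_append hβ with ⟨γ, β, rfl, h1, h2⟩ | ⟨γ, t, β, p, q', rfl, h1, h2, h3, h4, h5⟩
  · exact ⟨α, q, γ, [], β, rfl, by rw [hs, h1]; simp, hq, hm, hα, .inl ⟨rfl, h2⟩⟩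
  · refine ⟨α, q, γ, p, .inr t :: β, rfl, by rw [hs, h4], hq, ?_, hα, .inr ⟨h2, t, β, rfl⟩⟩
    by_contra h0
    have h6 := congrArg List.length h4
    have h7 := congrArg List.length h1
    simp only [List.length_append, length_M] at h6 h7
    have := D.uniq_append (s := s) (s' := t) (α := q ++ D.word γ ++ p.take (p.length - D.m))
      (α' := D.X t ++ p.take (p.length - D.m)) (f := p.drop (p.length - D.m))
      (β := []) (β' := q' ++ D.Z t) (by simp; omega)
      (by rw [hs, h4]; simp)
      (by
        rw [rel_eq, h1]
        simp only [List.append_assoc, ← List.append_assoc (List.take _ p), List.take_append_drop])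
    obtain ⟨rfl, h8⟩ := this
    have := List.length_pos_iff.2 h3
    simp [length_X] at h8
    omega

/-- Every occurrence of a relation word in a marked word that is equivalent to a parse is an
occurrence of the marked relation word. -/
theorem occurrence_lift {u : List A} {κ₀ κ : List (A ⊕ S)} (hp : D.Parse u κ₀) (hi : D.Inv κ₀ κ)
    {a b : List A} {s : S} (h : D.word κ = a ++ (D.rel s ++ b)) :
    ∃ α β, κ = α ++ (D.mrel s ++ β) ∧ D.word α = a ∧ D.word β = b := by
  have hm := D.m_pos
  obtain ⟨α, q, γ, q', β, rfl, hs, hq, hq', hα, hβ⟩ := D.occurrence_cut h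
  rcases exists_letters_or_marker γ with ⟨y, rfl⟩ | ⟨y₁, t, γ₂, rfl⟩
  · rw [word_letters] at hs
    exact (no_letter_occurrence hp hi hs hq hq').elim
  · have hM := D.length_M_ge t
    have hs' : D.rel s = q ++ y₁ ++ (D.M t ++ (D.word γ₂ ++ q')) := by
      rw [hs]; simp
    obtain ⟨rfl, hlen⟩ := D.uniq_append (by omega) hs' (D.rel_eq t)
    have hs'' := D.rel_eq s
    rw [hs'] at hs''
    obtain ⟨hX, hMZ⟩ := List.append_inj hs'' hlen
    have hZ := List.append_cancel_left hMZ
    have hXl := congrArg List.length hX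
    have hZl := congrArg List.length hZ
    simp only [List.length_append, length_X, length_Z] at hXl hZl
    have e2 := D.letters_of_short (γ := γ₂) (by omega)
    rw [e2] at hi
    rw [e2]
    rcases hα with ⟨rfl, hα⟩ | ⟨hq0, α', t, rfl⟩
    · rcases hβ with ⟨rfl, hβ⟩ | ⟨hq0', t, β', rfl⟩
      · simp only [List.nil_append, List.append_nil] at hX hZ
        exact ⟨α, β, by simp [mrel, ← hX, ← hZ], hα, hβ⟩
      · refine (no_marker_in_right_margin hp (α := α ++ y₁.map .inl) (s := s)
          (t := t) (δ := β') (y := D.word γ₂) ?_ hZ.symm hq0' hq').elim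
        simpa using hi
    · refine (no_marker_in_left_margin hp (α := α') (s := s)
          (t := t) (δ := (D.word γ₂).map .inl ++ β) (y := y₁) ?_ hX.symm hq0 hq).elim
      simpa using hi

/-- Equivalence of words is equivalence of marked words. -/
theorem reach_iff {u : List A} {κ₀ : List (A ⊕ S)} (hp : D.Parse u κ₀) {v : List A} :
    Relation.ReflTransGen D.Step u v ↔ ∃ κ, D.MReach κ₀ κ ∧ D.word κ = v := by
  constructor
  · intro h
    induction h with
    | refl => exact ⟨κ₀, .refl, hp.word_eq⟩
    | tail _ h ih =>
      obtain ⟨κ, hκ, rfl⟩ := ih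
      obtain ⟨a, b, s, h1, rfl⟩ := h
      obtain ⟨α, β, rfl, rfl, rfl⟩ := D.occurrence_lift hp hκ.inv h1
      exact ⟨_, hκ.tail ⟨α, β, s, rfl, rfl⟩, by simp [word_mrel]⟩
  · rintro ⟨κ, hκ, rfl⟩
    rw [← hp.word_eq]
    exact hκ.reach

/-! ### Equivalence of marked words by recursion on the markers -/

/-- Steps on a marked word that stands behind a marker (or at the beginning of a word, if there is
`none`). The marker in front can be replaced when its right margin is present; its left margin is
ignored. -/
inductive HStep : Option S × List (A ⊕ S) → Option S × List (A ⊕ S) → Prop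
  | inner {t : Option S} {w w' : List (A ⊕ S)} (h : D.MStep w w') : HStep (t, w) (t, w')
  | head (r : S) (x : List (A ⊕ S)) :
      HStep (some r, (D.Z r).map .inl ++ x) (some (D.bar r), (D.Z (D.bar r)).map .inl ++ x)

/-- Equivalence of marked words behind a marker. -/
def HReach : Option S × List (A ⊕ S) → Option S × List (A ⊕ S) → Prop :=
  Relation.ReflTransGen D.HStep

/-- The letters between two neighbouring markers, the first of which may be missing. -/
abbrev Gap (A S : Type) : Type := Option S × List A × S

/-- Replacing the left marker of a gap, as far as the gap is concerned. -/
inductive LStep : Gap A S → Gap A S → Prop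
  | mk (r : S) (y : List A) (s : S) :
      LStep (some r, D.Z r ++ y, s) (some (D.bar r), D.Z (D.bar r) ++ y, s)

/-- Replacing one of the markers of a gap, as far as the gap is concerned. -/
inductive GStep : Gap A S → Gap A S → Prop
  | left {g g' : Gap A S} (h : D.LStep g g') : GStep g g'
  | right (t : Option S) (y : List A) (s : S) :
      GStep (t, y ++ D.X s, s) (t, y ++ D.X (D.bar s), D.bar s)

/-- Changes of a gap that come from replacing its left marker. -/
def LReach : Gap A S → Gap A S → Prop := Relation.ReflTransGen D.LStep

/-- Changes of a gap that come from replacing its markers. -/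
def GReach : Gap A S → Gap A S → Prop := Relation.ReflTransGen D.GStep

/-- The marker `t` can be replaced in front of some word equivalent to `w`. -/
def Flips (t : S) (w : List (A ⊕ S)) : Prop := ∃ x, D.MReach w ((D.Z t).map .inl ++ x)

/-- A gap, followed by a marked word. -/
def Gap.append (g : Gap A S) (w : List (A ⊕ S)) : Option S × List (A ⊕ S) :=
  (g.1, g.2.1.map .inl ++ .inr g.2.2 :: w)

theorem first_marker_inj {y y' : List A} {s s' : S} {w w' : List (A ⊕ S)}
    (h : y.map .inl ++ .inr s :: w = y'.map .inl ++ .inr s' :: w') : y = y' ∧ s = s' ∧ w = w' := by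
  induction y generalizing y' with
  | nil =>
    cases y' with
    | nil => simpa using h
    | cons e y' => simp at h
  | cons e y ih =>
    cases y' with
    | nil => simp at h
    | cons e' y' =>
      simp only [List.map_cons, List.cons_append, List.cons.injEq, Sum.inl.injEq] at h
      obtain ⟨h1, h2, h3⟩ := ih h.2
      exact ⟨by rw [h.1, h1], h2, h3⟩

theorem Gap.append_inj {g g' : Gap A S} {w w' : List (A ⊕ S)} (h : g.append w = g'.append w') :
    g = g' ∧ w = w' := by
  obtain ⟨t, y, s⟩ := g
  obtain ⟨t', y', s'⟩ := g'
  simp only [Gap.append, Prod.mk.injEq] at h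
  obtain ⟨rfl, h⟩ := h
  obtain ⟨rfl, rfl, rfl⟩ := first_marker_inj h
  exact ⟨rfl, rfl⟩

theorem letters_prefix_marker {z y : List A} {s : S} {w x : List (A ⊕ S)}
    (h : y.map .inl ++ .inr s :: w = z.map .inl ++ x) :
    ∃ y', y = z ++ y' ∧ x = y'.map .inl ++ .inr s :: w := by
  induction z generalizing y with
  | nil => exact ⟨y, rfl, h.symm⟩
  | cons e z ih =>
    cases y with
    | nil => simp at h
    | cons e' y =>
      simp only [List.map_cons, List.cons_append, List.cons.injEq, Sum.inl.injEq] at h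
      obtain ⟨y', rfl, rfl⟩ := ih h.2
      exact ⟨y', by simp [h.1], rfl⟩

theorem HStep.symm {D : SmallOverlap A S} {p p' : Option S × List (A ⊕ S)} (h : D.HStep p p') :
    D.HStep p' p := by
  cases h with
  | inner h => exact .inner h.symm
  | head r x =>
    have := HStep.head (D := D) (D.bar r) x
    rwa [D.bar_bar] at this

theorem HReach.symm {D : SmallOverlap A S} {p p' : Option S × List (A ⊕ S)} (h : D.HReach p p') :
    D.HReach p' p := by
  induction h with
  | refl => exact .refl
  | tail _ h ih => exact .head h.symm ih

theorem GStep.symm {D : SmallOverlap A S} {g g' : Gap A S} (h : D.GStep g g') : D.GStep g' g := by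
  cases h with
  | left h =>
    cases h with
    | mk r y s =>
      have := LStep.mk (D := D) (D.bar r) y s
      rw [D.bar_bar] at this
      exact .left this
  | right t y s =>
    have := GStep.right (D := D) t y (D.bar s)
    rwa [D.bar_bar] at this

theorem GReach.symm {D : SmallOverlap A S} {g g' : Gap A S} (h : D.GReach g g') :
    D.GReach g' g := by
  induction h with
  | refl => exact .refl
  | tail _ h ih => exact .head h.symm ih

theorem LReach.greach {D : SmallOverlap A S} {g g' : Gap A S} (h : D.LReach g g') :
    D.GReach g g' := by
  induction h with
  | refl => exact .refl
  | tail _ h ih => exact .tail ih (.left h)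

theorem LReach.marker_eq {D : SmallOverlap A S} {g g' : Gap A S} (h : D.LReach g g') :
    g'.2.2 = g.2.2 := by
  induction h with
  | refl => rfl
  | tail _ h ih => cases h; exact ih

theorem MReach.hreach {D : SmallOverlap A S} {w w' : List (A ⊕ S)} (h : D.MReach w w')
    (t : Option S) : D.HReach (t, w) (t, w') := by
  induction h with
  | refl => exact .refl
  | tail _ h ih => exact .tail ih (.inner h)

theorem hreach_none {w w' : List (A ⊕ S)} : D.HReach (none, w) (none, w') ↔ D.MReach w w' := by
  refine ⟨fun h => ?_, fun h => h.hreach none⟩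
  suffices ∀ p, D.HReach (none, w) p → p.1 = none ∧ D.MReach w p.2 from (this _ h).2
  intro p h
  induction h with
  | refl => exact ⟨rfl, .refl⟩
  | tail _ h ih =>
    cases h with
    | inner h => exact ⟨ih.1, ih.2.tail h⟩
    | head r x => simp at ih

theorem Flips.of_reach {D : SmallOverlap A S} {t : S} {w w' : List (A ⊕ S)} (h : D.Flips t w)
    (hw : D.MReach w w') : D.Flips t w' := by
  obtain ⟨x, hx⟩ := h
  exact ⟨x, hw.symm.trans hx⟩

theorem flips_Z (t : S) (x : List (A ⊕ S)) : D.Flips t ((D.Z t).map .inl ++ x) := ⟨x, .refl⟩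

/-- A step on a marked word that starts with letters and a marker uses either that marker or
happens behind it. -/
theorem MStep.append_marker {D : SmallOverlap A S} {y : List A} {s : S} {w κ : List (A ⊕ S)}
    (h : D.MStep (y.map .inl ++ .inr s :: w) κ) :
    (∃ w', D.MStep w w' ∧ κ = y.map .inl ++ .inr s :: w') ∨
    ∃ y' x, y = y' ++ D.X s ∧ w = (D.Z s).map .inl ++ x ∧
      κ = (y' ++ D.X (D.bar s)).map .inl ++ .inr (D.bar s) :: ((D.Z (D.bar s)).map .inl ++ x) := by
  obtain ⟨α, β, r, h, rfl⟩ := h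
  rcases exists_letters_or_marker α with ⟨a, rfl⟩ | ⟨a, t, γ, rfl⟩
  · have h' : y.map Sum.inl ++ Sum.inr s :: w
        = (a ++ D.X r).map Sum.inl ++ Sum.inr r :: ((D.Z r).map Sum.inl ++ β) := by
      rw [h]; simp [mrel]
    obtain ⟨rfl, rfl, rfl⟩ := first_marker_inj h'
    exact .inr ⟨a, β, rfl, rfl, by simp [mrel]⟩
  · rw [List.append_assoc, List.cons_append] at h
    obtain ⟨rfl, rfl, rfl⟩ := first_marker_inj h
    exact .inl ⟨_, ⟨γ, β, r, rfl, rfl⟩, by simp⟩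

theorem mstep_context {w w' : List (A ⊕ S)} (h : D.MStep w w') (a : List (A ⊕ S)) :
    D.MStep (a ++ w) (a ++ w') := by
  obtain ⟨α, β, s, rfl, rfl⟩ := h
  exact ⟨a ++ α, β, s, by simp, by simp⟩

theorem hreach_append_of_mreach (g : Gap A S) {w w' : List (A ⊕ S)} (h : D.MReach w w') :
    D.HReach (g.append w) (g.append w') := by
  induction h with
  | refl => exact .refl
  | tail _ h ih =>
    refine .tail ih (.inner ?_)
    have h1 := D.mstep_context h (g.2.1.map .inl ++ [.inr g.2.2])
    rwa [List.append_assoc, List.append_assoc] at h1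

theorem LStep.append {D : SmallOverlap A S} {g g' : Gap A S} (h : D.LStep g g')
    (w : List (A ⊕ S)) : D.HStep (g.append w) (g'.append w) := by
  cases h with
  | mk r y s =>
    have := HStep.head (D := D) r (y.map .inl ++ .inr s :: w)
    simpa [Gap.append] using this

theorem hreach_append_of_lreach {g g' : Gap A S} (h : D.LReach g g') (w : List (A ⊕ S)) :
    D.HReach (g.append w) (g'.append w) := by
  induction h with
  | refl => exact .refl
  | tail _ h ih => exact .tail ih (h.append w)

theorem hstep_right (t : Option S) (y : List A) (s : S) (x : List (A ⊕ S)) :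
    D.HStep (Gap.append (t, y ++ D.X s, s) ((D.Z s).map .inl ++ x))
      (Gap.append (t, y ++ D.X (D.bar s), D.bar s) ((D.Z (D.bar s)).map .inl ++ x)) :=
  .inner ⟨y.map .inl, x, s, by simp [mrel], by simp [mrel]⟩

/-- While the left margin of the last marker of a gap is present, everything that can happen behind
that marker can happen. -/
theorem hreach_append_of_hreach (t : Option S) (y : List A) {s s' : S} {w w' : List (A ⊕ S)}
    (h : D.HReach (some s, w) (some s', w')) :
    D.HReach (Gap.append (t, y ++ D.X s, s) w) (Gap.append (t, y ++ D.X s', s') w') := by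
  suffices ∀ p, D.HReach (some s, w) p → ∃ s₁, p.1 = some s₁ ∧
      D.HReach (Gap.append (t, y ++ D.X s, s) w) (Gap.append (t, y ++ D.X s₁, s₁) p.2) by
    obtain ⟨s₁, h1, h2⟩ := this _ h
    obtain rfl : s' = s₁ := by simpa using h1
    exact h2
  intro p h
  induction h with
  | refl => exact ⟨s, rfl, .refl⟩
  | tail _ h ih =>
    obtain ⟨s₁, h1, h2⟩ := ih
    cases h with
    | inner h => exact ⟨s₁, h1, h2.trans (D.hreach_append_of_mreach _ (.single h))⟩
    | head r x =>
      obtain rfl : r = s₁ := by simpa using h1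
      exact ⟨_, rfl, h2.tail (D.hstep_right t y r x)⟩

/-- If the last marker of a gap can be replaced, then everything that can happen to the gap alone
can happen. -/
theorem exists_hreach_of_greach {g g' : Gap A S} (h : D.GReach g g') {w : List (A ⊕ S)}
    (hw : D.Flips g.2.2 w) : ∃ w', D.Flips g'.2.2 w' ∧
      D.HReach (some g.2.2, w) (some g'.2.2, w') ∧ D.HReach (g.append w) (g'.append w') := by
  induction h with
  | refl => exact ⟨w, hw, .refl, .refl⟩
  | tail _ h ih =>
    obtain ⟨w', h1, h2, h3⟩ := ih
    cases h with
    | left h =>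
      have h4 := h.append (D := D) w'
      cases h with
      | mk r y s => exact ⟨w', h1, h2, h3.tail h4⟩
    | right t y s =>
      obtain ⟨x, hx⟩ := h1
      exact ⟨_, D.flips_Z _ x, (h2.trans (hx.hreach _)).tail (.head s x),
        (h3.trans (D.hreach_append_of_mreach _ hx)).tail (D.hstep_right t y s x)⟩

/-- The right-hand side of `hreach_append_iff`: either the last marker of the gap is never replaced,
or it can be replaced freely as long as its left margin is present. -/
def GapReach (g : Gap A S) (w : List (A ⊕ S)) (g' : Gap A S) (w' : List (A ⊕ S)) : Prop :=
  (D.LReach g g' ∧ D.MReach w w') ∨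
  ((∃ t y s, D.GReach g (t, y ++ D.X s, s) ∧ D.GReach (t, y ++ D.X s, s) g') ∧
    D.Flips g.2.2 w ∧ D.Flips g'.2.2 w' ∧ D.HReach (some g.2.2, w) (some g'.2.2, w'))

/-- The invariant that proves one direction of `hreach_append_iff`. -/
theorem exists_gapReach {g : Gap A S} {w : List (A ⊕ S)} {p : Option S × List (A ⊕ S)}
    (h : D.HReach (g.append w) p) : ∃ g' w', p = g'.append w' ∧ D.GapReach g w g' w' := by
  induction h with
  | refl => exact ⟨g, w, rfl, .inl ⟨.refl, .refl⟩⟩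
  | @tail p p' _ h ih =>
    obtain ⟨⟨t, y, s⟩, w₁, rfl, h1⟩ := ih
    generalize hp : Gap.append (t, y, s) w₁ = p at h
    cases h with
    | @inner t' κ κ' h =>
      simp only [Gap.append, Prod.mk.injEq] at hp
      obtain ⟨rfl, rfl⟩ := hp
      rcases h.append_marker with ⟨w', h2, rfl⟩ | ⟨y', x, rfl, rfl, rfl⟩
      · refine ⟨(t, y, s), w', rfl, ?_⟩
        rcases h1 with ⟨h3, h4⟩ | ⟨h3, h4, h5, h6⟩
        · exact .inl ⟨h3, h4.tail h2⟩
        · exact .inr ⟨h3, h4, h5.of_reach (.single h2), h6.tail (.inner h2)⟩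
      · refine ⟨(t, y' ++ D.X (D.bar s), D.bar s), _, rfl, .inr ?_⟩
        rcases h1 with ⟨h3, h4⟩ | ⟨⟨t₁, y₁, s₁, h3, h3'⟩, h4, h5, h6⟩
        · obtain rfl := h3.marker_eq
          exact ⟨⟨t, y', g.2.2, h3.greach, .single (.right _ _ _)⟩, ⟨x, h4⟩, D.flips_Z _ _,
            (h4.hreach _).tail (.head _ _)⟩
        · exact ⟨⟨t₁, y₁, s₁, h3, h3'.tail (.right _ _ _)⟩, h4, D.flips_Z _ _,
            h6.tail (.head _ _)⟩
    | head r x =>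
      simp only [Gap.append, Prod.mk.injEq] at hp
      obtain ⟨rfl, hp⟩ := hp
      obtain ⟨y', rfl, rfl⟩ := letters_prefix_marker hp
      refine ⟨(some (D.bar r), D.Z (D.bar r) ++ y', s), w₁, by simp [Gap.append], ?_⟩
      have hL := LStep.mk (D := D) r y' s
      rcases h1 with ⟨h3, h4⟩ | ⟨⟨t₁, y₁, s₁, h3, h3'⟩, h4, h5, h6⟩
      · exact .inl ⟨h3.tail hL, h4⟩
      · exact .inr ⟨⟨t₁, y₁, s₁, h3, h3'.tail (.left hL)⟩, h4, h5, h6⟩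

/-- Equivalence behind a marker, in terms of the gap up to the next marker and of the marked words
behind that one. -/
theorem hreach_append_iff {g g' : Gap A S} {w w' : List (A ⊕ S)} :
    D.HReach (g.append w) (g'.append w') ↔ D.GapReach g w g' w' := by
  constructor
  · intro h
    obtain ⟨g₁, w₁, h1, h2⟩ := D.exists_gapReach h
    obtain ⟨rfl, rfl⟩ := Gap.append_inj h1
    exact h2
  · rintro (⟨h1, h2⟩ | ⟨⟨t, y, s, h1, h2⟩, h3, h4, h5⟩)
    · exact (D.hreach_append_of_lreach h1 w).trans (D.hreach_append_of_mreach g' h2)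
    · -- both sides are moved to the gap in which the left margin of the last marker is present
      obtain ⟨w₁, -, h6, h7⟩ := D.exists_hreach_of_greach h1 h3
      obtain ⟨w₂, -, h8, h9⟩ := D.exists_hreach_of_greach h2.symm h4
      exact (h7.trans (D.hreach_append_of_hreach t y ((h6.symm.trans h5).trans h8))).trans h9.symm

/-- When the marker in front of a gap can be replaced, in terms of the gap and of the marked word
behind it. -/
theorem flips_append_iff {t : S} {y : List A} {s : S} {w : List (A ⊕ S)} :
    D.Flips t (y.map .inl ++ .inr s :: w) ↔ D.Z t <+: y ∨
      (D.Flips s w ∧ ∃ y' s', D.GReach (none, y, s) (none, y', s') ∧ D.Z t <+: y') := by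
  constructor
  · rintro ⟨x, hx⟩
    obtain ⟨⟨t', y', s'⟩, w', h1, h2⟩ :=
      D.exists_gapReach (g := (none, y, s)) (w := w) (hx.hreach none)
    simp only [Gap.append, Prod.mk.injEq] at h1
    obtain ⟨rfl, h1⟩ := h1
    obtain ⟨y'', rfl, rfl⟩ := letters_prefix_marker h1.symm
    rcases h2 with ⟨h3, -⟩ | ⟨⟨t₁, y₁, s₁, h3, h3'⟩, h4, -, -⟩
    · left
      rcases Relation.ReflTransGen.cases_head h3 with h5 | ⟨g, h5, -⟩
      · obtain ⟨-, rfl, -⟩ : True ∧ y = D.Z t ++ y'' ∧ s = s' := by simpa using h5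
        exact List.prefix_append _ _
      · cases h5
    · exact .inr ⟨h4, _, _, h3.trans h3', List.prefix_append _ _⟩
  · rintro (⟨x, rfl⟩ | ⟨h1, y', s', h2, ⟨x, rfl⟩⟩)
    · exact ⟨x.map .inl ++ .inr s :: w, by rw [List.map_append, List.append_assoc]; exact .refl⟩
    · obtain ⟨w', -, -, h3⟩ := D.exists_hreach_of_greach h2 h1
      have h4 := D.hreach_none.1 h3
      exact ⟨x.map .inl ++ .inr s' :: w', by simpa using h4⟩

/-! ### Long gaps -/

theorem letters_of_shape {x : List A} {w κ : List (A ⊕ S)}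
    (h : κ.map Sum.isLeft = (x.map Sum.inl ++ w).map Sum.isLeft) :
    ∃ (x' : List A) (w' : List (A ⊕ S)), κ = x'.map .inl ++ w' ∧ x'.length = x.length := by
  induction x generalizing κ with
  | nil => exact ⟨[], κ, rfl, rfl⟩
  | cons e x ih =>
    cases κ with
    | nil => simp at h
    | cons a κ =>
      simp only [List.map_cons, List.cons_append, List.cons.injEq] at h
      obtain ⟨x', w', rfl, h2⟩ := ih h.2
      cases a with
      | inl a => exact ⟨a :: x', w', rfl, by simp [h2]⟩
      | inr a => simp at h

theorem MReach.letters {D : SmallOverlap A S} {y : List A} {κ : List (A ⊕ S)}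
    (h : D.MReach (y.map .inl) κ) : κ = y.map .inl := by
  induction h with
  | refl => rfl
  | tail _ h ih =>
    subst ih
    obtain ⟨α, β, s, h, -⟩ := h
    have : Sum.inr s ∈ y.map (Sum.inl : A → A ⊕ S) := by rw [h]; simp [mrel]
    simp at this

theorem map_inl_append_inj {z z' : List A} {κ κ' : List (A ⊕ S)}
    (h : z.map .inl ++ κ = z'.map .inl ++ κ') (hl : z.length = z'.length) : z = z' ∧ κ = κ' := by
  obtain ⟨h1, h2⟩ := List.append_inj h (by simpa using hl)
  exact ⟨List.map_injective_iff.2 Sum.inl_injective h1, h2⟩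

theorem HStep.append {D : SmallOverlap A S} {t t' : Option S} {a a' : List (A ⊕ S)}
    (h : D.HStep (t, a) (t', a')) (κ : List (A ⊕ S)) : D.HStep (t, a ++ κ) (t', a' ++ κ) := by
  cases h with
  | inner h =>
    obtain ⟨α, β, s, rfl, rfl⟩ := h
    exact .inner ⟨α, β ++ κ, s, by simp, by simp⟩
  | head r x =>
    rw [List.append_assoc, List.append_assoc]
    exact .head r _

theorem HReach.append {D : SmallOverlap A S} {p p' : Option S × List (A ⊕ S)}
    (h : D.HReach p p') (κ : List (A ⊕ S)) : D.HReach (p.1, p.2 ++ κ) (p'.1, p'.2 ++ κ) := by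
  induction h with
  | refl => exact .refl
  | tail _ h ih => exact .tail ih (HStep.append h κ)

/-- Behind a marker that is followed by two margins full of letters, the first margin and the rest
do not influence each other. -/
theorem exists_cut {t : Option S} {z x : List A} {w : List (A ⊕ S)} (hz : z.length = 4 * D.m)
    (hx : x.length = 4 * D.m) {p : Option S × List (A ⊕ S)}
    (h : D.HReach (t, z.map .inl ++ (x.map .inl ++ w)) p) :
    ∃ (t' : Option S) (z' : List A) (κ : List (A ⊕ S)),
      p = (t', z'.map .inl ++ κ) ∧ z'.length = 4 * D.m ∧
      D.HReach (t, z.map .inl) (t', z'.map .inl) ∧ D.MReach (x.map .inl ++ w) κ := by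
  induction h with
  | refl => exact ⟨t, z, _, rfl, hz, .refl, .refl⟩
  | @tail p p' _ h ih =>
    obtain ⟨t₁, z₁, κ₁, rfl, h1, h2, h3⟩ := ih
    generalize hp : (t₁, z₁.map Sum.inl ++ κ₁) = p at h
    cases h with
    | @inner t' κ κ' h =>
      simp only [Prod.mk.injEq] at hp
      obtain ⟨rfl, rfl⟩ := hp
      obtain ⟨α, β, s, h4, rfl⟩ := h
      obtain ⟨x', w', rfl, hx'⟩ := letters_of_shape h3.shape
      have hα : (z₁.map (Sum.inl : A → A ⊕ S)).length ≤ α.length := by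
        by_contra h0
        have h5 : IsMark ([] ++ ((z₁ ++ x').map Sum.inl ++ w')) (α.length + 4 * D.m) :=
          ⟨s, by rw [List.nil_append, List.map_append, List.append_assoc, h4,
            D.getElem?_mrel_mid]⟩
        simp only [List.length_map] at h0
        exact not_isMark_block _ _ _ (by simp) (by simp; omega) h5
      have h5 : z₁.map Sum.inl <+: α := by
        exact List.prefix_of_prefix_length_le (List.prefix_append _ _)
          (h4 ▸ List.prefix_append α _) hα
      obtain ⟨α, rfl⟩ := h5
      rw [List.append_assoc] at h4 ⊢
      exact ⟨_, z₁, _, rfl, h1, h2, h3.tail ⟨α, β, s, List.append_cancel_left h4, rfl⟩⟩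
    | head r y =>
      simp only [Prod.mk.injEq] at hp
      obtain ⟨rfl, hp⟩ := hp
      obtain ⟨rfl, rfl⟩ := map_inl_append_inj hp (by rw [h1, length_Z])
      refine ⟨_, D.Z (D.bar r), _, rfl, D.length_Z _, h2.tail ?_, h3⟩
      simpa using HStep.head (D := D) r []

theorem hreach_cut_iff {t t' : Option S} {z z' x : List A} {w κ : List (A ⊕ S)}
    (hz : z.length = 4 * D.m) (hz' : z'.length = 4 * D.m) (hx : x.length = 4 * D.m) :
    D.HReach (t, z.map .inl ++ (x.map .inl ++ w)) (t', z'.map .inl ++ κ) ↔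
      D.HReach (t, z.map .inl) (t', z'.map .inl) ∧ D.MReach (x.map .inl ++ w) κ := by
  constructor
  · intro h
    obtain ⟨t₁, z₁, κ₁, h1, h2, h3, h4⟩ := D.exists_cut hz hx h
    simp only [Prod.mk.injEq] at h1
    obtain ⟨rfl, h1⟩ := h1
    obtain ⟨rfl, rfl⟩ := map_inl_append_inj h1 (by rw [hz', h2])
    exact ⟨h3, h4⟩
  · rintro ⟨h1, h2⟩
    refine (h1.append _).trans ?_
    induction h2 with
    | refl => exact .refl
    | tail _ h ih => exact .tail ih (.inner (D.mstep_context h _))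

theorem flips_cut_iff {t : S} {z x : List A} {w : List (A ⊕ S)} (hz : z.length = 4 * D.m)
    (hx : x.length = 4 * D.m) : D.Flips t (z.map .inl ++ (x.map .inl ++ w)) ↔ D.Z t = z := by
  constructor
  · rintro ⟨κ, h⟩
    obtain ⟨h1, -⟩ := (D.hreach_cut_iff (t' := none) hz (D.length_Z t) hx).1 (h.hreach none)
    exact List.map_injective_iff.2 Sum.inl_injective (D.hreach_none.1 h1).letters
  · rintro rfl
    exact D.flips_Z _ _

/-! ### Equivalence of marked words is a finite-state property -/

/-- A pair of symbols in the same place of two equivalent marked words: two letters, or a marker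
and either the same marker again (`false`) or the other one of its pair (`true`). -/
abbrev SymbolPair (A S : Type) : Type := A × A ⊕ S × Bool

/-- The symbol of the first marked word. -/
def fstSymbol : SymbolPair A S → A ⊕ S
  | .inl p => .inl p.1
  | .inr p => .inr p.1

/-- The symbol of the second marked word. -/
def sndSymbol : SymbolPair A S → A ⊕ S
  | .inl p => .inl p.2
  | .inr p => .inr (if p.2 then D.bar p.1 else p.1)

/-- The questions that are asked about a pair of marked words: are they equivalent behind given
markers and given short words, and can a given marker be replaced in front of a given short word
and the first, or the second, of them? -/
abbrev Question : Type :=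
  {yy : List (A × A) // yy.length ≤ 8 * D.m} × Option S × Option S ⊕
    ({y : List A // y.length ≤ 8 * D.m} × S ⊕ {y : List A // y.length ≤ 8 * D.m} × S)

/-- The answers to all questions. -/
def profile (l : List (SymbolPair A S)) : D.Question → Prop
  | .inl (yy, t, t') => D.HReach (t, (yy.1.map Prod.fst).map .inl ++ l.map fstSymbol)
      (t', (yy.1.map Prod.snd).map .inl ++ l.map D.sndSymbol)
  | .inr (.inl (y, s)) => D.Flips s (y.1.map .inl ++ l.map fstSymbol)
  | .inr (.inr (y, s)) => D.Flips s (y.1.map .inl ++ l.map D.sndSymbol)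

theorem flips_letter_congr {l₁ l₂ : List (A ⊕ S)}
    (h : ∀ (y : List A), y.length ≤ 8 * D.m → ∀ s,
      D.Flips s (y.map .inl ++ l₁) ↔ D.Flips s (y.map .inl ++ l₂))
    {y : List A} (hy : y.length ≤ 8 * D.m) (e : A) (s : S) :
    D.Flips s (y.map .inl ++ .inl e :: l₁) ↔ D.Flips s (y.map .inl ++ .inl e :: l₂) := by
  rcases hy.lt_or_eq with h1 | h1
  · simpa using h (y ++ [e]) (by simpa using h1) s
  · rw [← List.take_append_drop (4 * D.m) y, List.map_append, List.append_assoc, List.append_assoc,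
      D.flips_cut_iff (by simp; omega) (by simp; omega),
      D.flips_cut_iff (by simp; omega) (by simp; omega)]

theorem flips_marker_congr {l₁ l₂ : List (A ⊕ S)} {r : S} (h : D.Flips r l₁ ↔ D.Flips r l₂)
    (y : List A) (s : S) :
    D.Flips s (y.map .inl ++ .inr r :: l₁) ↔ D.Flips s (y.map .inl ++ .inr r :: l₂) := by
  rw [flips_append_iff, flips_append_iff, h]

/-- The answers for a pair of marked words can be computed from the answers for the pair without
its first symbols. A letter is added to the short words in front of the rest, or if these have
already their maximal length, the words are cut in two by `hreach_cut_iff`; a marker is dealt with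
by `hreach_append_iff`. -/
theorem profile_cons_congr {l₁ l₂ : List (SymbolPair A S)} (h : D.profile l₁ = D.profile l₂)
    (p : SymbolPair A S) : D.profile (p :: l₁) = D.profile (p :: l₂) := by
  have hF : ∀ (y : List A), y.length ≤ 8 * D.m → ∀ s,
      D.Flips s (y.map .inl ++ l₁.map fstSymbol) ↔ D.Flips s (y.map .inl ++ l₂.map fstSymbol) :=
    fun y hy s => (congrFun h (.inr (.inl (⟨y, hy⟩, s)))).to_iff
  have hF' : ∀ (y : List A), y.length ≤ 8 * D.m → ∀ s,
      D.Flips s (y.map .inl ++ l₁.map D.sndSymbol) ↔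
        D.Flips s (y.map .inl ++ l₂.map D.sndSymbol) :=
    fun y hy s => (congrFun h (.inr (.inr (⟨y, hy⟩, s)))).to_iff
  have hR : ∀ (yy : List (A × A)), yy.length ≤ 8 * D.m → ∀ t t',
      D.HReach (t, (yy.map Prod.fst).map .inl ++ l₁.map fstSymbol)
        (t', (yy.map Prod.snd).map .inl ++ l₁.map D.sndSymbol) ↔
      D.HReach (t, (yy.map Prod.fst).map .inl ++ l₂.map fstSymbol)
        (t', (yy.map Prod.snd).map .inl ++ l₂.map D.sndSymbol) :=
    fun yy hy t t' => (congrFun h (.inl (⟨yy, hy⟩, t, t'))).to_iff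
  rcases p with ⟨e, e'⟩ | ⟨s, b⟩
  · funext q
    rcases q with ⟨⟨yy, hy⟩, t, t'⟩ | ⟨⟨y, hy⟩, s⟩ | ⟨⟨y, hy⟩, s⟩
    · apply propext
      simp only [profile, List.map_cons, fstSymbol, sndSymbol]
      rcases hy.lt_or_eq with h1 | h1
      · simpa using hR (yy ++ [(e, e')]) (by simpa using h1) t t'
      · have key : ∀ l : List (SymbolPair A S),
            D.HReach (t, (yy.map Prod.fst).map .inl ++ .inl e :: l.map fstSymbol)
              (t', (yy.map Prod.snd).map .inl ++ .inl e' :: l.map D.sndSymbol) ↔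
            D.HReach (t, ((yy.take (4 * D.m)).map Prod.fst).map .inl)
              (t', ((yy.take (4 * D.m)).map Prod.snd).map .inl) ∧
            D.HReach (none, ((yy.drop (4 * D.m) ++ [(e, e')]).map Prod.fst).map .inl
                ++ l.map fstSymbol)
              (none, ((yy.drop (4 * D.m) ++ [(e, e')]).map Prod.snd).map .inl
                ++ l.map D.sndSymbol) := by
          intro l
          conv_lhs => rw [← List.take_append_drop (4 * D.m) yy]
          rw [hreach_none]
          simp only [List.map_append, List.append_assoc]
          rw [D.hreach_cut_iff (by simp; omega) (by simp; omega) (by simp; omega)]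
          simp
        rw [key, key, hR _ (by have := D.m_pos; simp; omega)]
    · exact propext (D.flips_letter_congr hF hy e s)
    · exact propext (D.flips_letter_congr hF' hy e' s)
  · funext q
    rcases q with ⟨⟨yy, hy⟩, t, t'⟩ | ⟨⟨y, hy⟩, s'⟩ | ⟨⟨y, hy⟩, s'⟩
    · have hM := hR [] (by simp) none none
      rw [hreach_none, hreach_none] at hM
      have e := fun w w' => D.hreach_append_iff (g := (t, yy.map Prod.fst, s))
        (g' := (t', yy.map Prod.snd, if b then D.bar s else s)) (w := w) (w' := w')
      have e1 := e (l₁.map fstSymbol) (l₁.map D.sndSymbol)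
      have e2 := e (l₂.map fstSymbol) (l₂.map D.sndSymbol)
      have hfst := hF [] (by simp) s
      have hsnd := hF' [] (by simp) (if b then D.bar s else s)
      have hcore := hR [] (by simp) (some s) (some (if b then D.bar s else s))
      simp only [List.map_nil, List.nil_append] at hM hfst hsnd hcore
      rw [GapReach, hM, hfst, hsnd, hcore] at e1
      exact propext (e1.trans e2.symm)
    · exact propext (D.flips_marker_congr (hF [] (by simp) s) y s')
    · exact propext (D.flips_marker_congr (hF' [] (by simp) _) y s')

end SmallOverlap

/-! ### A Turing machine that reads two words with bounded look-ahead -/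

namespace PairReader

/-- The stacks of the machine: the input, the first word reversed, the first word, the output. -/
inductive Stk
  | inp | rev | fwd | out
  deriving DecidableEq

instance : Fintype Stk := ⟨{.inp, .rev, .fwd, .out}, by rintro (_ | _ | _ | _) <;> simp⟩

/-- The alphabets of the stacks. -/
abbrev Γ (A : Type) : Stk → Type
  | .inp => Option A
  | .rev => A
  | .fwd => A
  | .out => Bool

/-- The phases of the computation: putting the first word, in reverse, on a stack of its own;
turning it over; reading the two words; removing what is left of the second word. -/
inductive Phase
  | split | back | read | clean
  deriving DecidableEq

instance : Fintype Phase :=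
  ⟨{.split, .back, .read, .clean}, by rintro (_ | _ | _ | _) <;> simp⟩

/-- Words of length at most `B`. -/
abbrev Window (A : Type) (B : ℕ) : Type := {l : List A // l.length ≤ B}

/-- The internal states: a symbol that has just been taken from a stack; while reading, a state `q`
and, for either word, its next letters together with the information that the stack of the word is
known to be empty; in the last phase, the result and whether the input is not known to be empty. -/
abbrev State (A Q : Type) (B : ℕ) : Type :=
  Option (Option A) ⊕ (Q × (Window A B × Bool) × (Window A B × Bool)) ⊕ (Bool × Bool)

/-- Append a letter to a window that is not full, or note that there is none left. -/
def Window.refill {A : Type} {B : ℕ} (w : Window A B × Bool) (o : Option A) : Window A B × Bool :=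
  match o with
  | none => (w.1, true)
  | some a => if h : w.1.1.length < B then (⟨w.1.1 ++ [a], by simpa using h⟩, w.2) else w

/-- Remove letters from the front of a window. -/
def Window.drop {A : Type} {B : ℕ} (w : Window A B) (i : ℕ) : Window A B :=
  ⟨w.1.drop i, by have := w.2; simp; omega⟩

end PairReader

/-- A deterministic device that reads two words from the left. In the state `q` it looks at the next
`B` letters of both words (or fewer, where a word ends), and passes to the state `(next q u v).1`
after reading `(next q u v).2.1` letters of the first and `(next q u v).2.2` letters of the second
word. It stops when the first word is used up, and accepts if the second word is used up as well and the
state satisfies `accept`. -/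
structure PairReader (A Q : Type) where
  B : ℕ
  B_pos : 0 < B
  start : Q
  next : Q → List A → List A → Q × ℕ × ℕ
  accept : Q → Prop
  next_take : ∀ q u v, next q (u.take B) (v.take B) = next q u v
  fst_le : ∀ q u v, (next q u v).2.1 ≤ B
  snd_le : ∀ q u v, (next q u v).2.2 ≤ B
  fst_pos : ∀ q u v, u ≠ [] → 0 < (next q u v).2.1

namespace PairReader

open Turing

variable {A Q : Type} (R : PairReader A Q)

/-- A letter has just been taken from a stack. -/
def isLetter {B : ℕ} : State A Q B → Bool
  | .inl (some (some _)) => true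
  | _ => false

/-- The letter that has just been taken from a stack, if there is one. -/
noncomputable def letterOf [Nonempty A] {B : ℕ} : State A Q B → A
  | .inl (some (some a)) => a
  | _ => Classical.arbitrary A

/-- The state in which the reading of the words starts. -/
def initial : State A Q R.B :=
  .inr (.inl (R.start, (⟨[], Nat.zero_le _⟩, false), (⟨[], Nat.zero_le _⟩, false)))

/-- The window of the first word is not full, and its stack is not known to be empty. -/
def needFst {B : ℕ} : State A Q B → Bool
  | .inr (.inl (_, w, _)) => decide (w.1.1.length < B) && !w.2
  | _ => false

/-- The window of the second word is not full, and its stack is not known to be empty. -/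
def needSnd {B : ℕ} : State A Q B → Bool
  | .inr (.inl (_, _, w)) => decide (w.1.1.length < B) && !w.2
  | _ => false

/-- Add a letter to the window of the first word. -/
def refillFst {B : ℕ} : State A Q B → Option A → State A Q B
  | .inr (.inl (q, w, w')), o => .inr (.inl (q, Window.refill w o, w'))
  | s, _ => s

/-- Add a letter to the window of the second word. -/
def refillSnd {B : ℕ} : State A Q B → Option (Option A) → State A Q B
  | .inr (.inl (q, w, w')), o => .inr (.inl (q, w, Window.refill w' o.join))
  | s, _ => s

/-- No letters of the first word are left, provided that its window has been refilled. -/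
def fstDone {B : ℕ} : State A Q B → Bool
  | .inr (.inl (_, w, _)) => w.1.1.isEmpty
  | _ => false

open Classical in
/-- Determine the result when the first word has been read. -/
noncomputable def finish : State A Q R.B → State A Q R.B
  | .inr (.inl (q, _, w')) => .inr (.inr (decide (w'.1.1 = [] ∧ R.accept q), true))
  | s => s

/-- One step of the reader. -/
def act : State A Q R.B → State A Q R.B
  | .inr (.inl (q, w, w')) =>
    .inr (.inl ((R.next q w.1.1 w'.1.1).1, (w.1.drop (R.next q w.1.1 w'.1.1).2.1, w.2),
      (w'.1.drop (R.next q w.1.1 w'.1.1).2.2, w'.2)))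
  | s => s

/-- The result, in the last phase. -/
def result {B : ℕ} : State A Q B → Bool
  | .inr (.inr (b, _)) => b
  | _ => false

/-- The input is not known to be empty, in the last phase. -/
def more {B : ℕ} : State A Q B → Bool
  | .inr (.inr (_, b)) => b
  | _ => false

/-- The program of the machine. -/
noncomputable def program [Nonempty A] : Phase → TM2.Stmt (Γ A) Phase (State A Q R.B)
  | .split => .pop .inp (fun _ o => .inl o) <|
      .branch isLetter (.push .rev letterOf (.goto fun _ => .split)) (.goto fun _ => .back)
  | .back => .pop .rev (fun _ o => .inl (o.map some)) <|
      .branch isLetter (.push .fwd letterOf (.goto fun _ => .back))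
        (.load (fun _ => R.initial) (.goto fun _ => .read))
  | .read => .branch needFst (.pop .fwd refillFst (.goto fun _ => .read)) <|
      .branch needSnd (.pop .inp refillSnd (.goto fun _ => .read)) <|
      .branch fstDone (.load R.finish (.goto fun _ => .clean)) <|
      .load R.act (.goto fun _ => .read)
  | .clean => .pop .inp (fun s o => .inr (.inr (result s, o.isSome))) <|
      .branch more (.goto fun _ => .clean) <|
      .push .out result <| .load (fun _ => .inl none) .halt

/-- The machine. -/
noncomputable def machine [Nonempty A] [Fintype A] [Finite Q] : FinTM2 where
  K := Stk
  k₀ := .inp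
  k₁ := .out
  Γ := Γ A
  Λ := Phase
  main := .split
  σ := State A Q R.B
  initialState := .inl none
  σFin := by
    have := (List.finite_length_le A R.B).to_subtype
    have : Finite (Window A R.B) := this
    exact Fintype.ofFinite _
  Γk₀Fin := inferInstanceAs (Fintype (Option A))
  m := R.program

/-- The contents of the stacks. -/
def contents (a : List (Option A)) (b c : List A) (d : List Bool) : ∀ k, List (Γ A k)
  | .inp => a
  | .rev => b
  | .fwd => c
  | .out => d

@[simp] theorem update_inp (a a' : List (Option A)) (b c : List A) (d : List Bool) :
    Function.update (contents a b c d) .inp a' = contents a' b c d := by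
  funext k; cases k <;> rfl

@[simp] theorem update_rev (a : List (Option A)) (b b' c : List A) (d : List Bool) :
    Function.update (contents a b c d) .rev b' = contents a b' c d := by
  funext k; cases k <;> rfl

@[simp] theorem update_fwd (a : List (Option A)) (b c c' : List A) (d : List Bool) :
    Function.update (contents a b c d) .fwd c' = contents a b c' d := by
  funext k; cases k <;> rfl

@[simp] theorem update_out (a : List (Option A)) (b c : List A) (d d' : List Bool) :
    Function.update (contents a b c d) .out d' = contents a b c d' := by
  funext k; cases k <;> rfl

theorem drop_append_of_window {l r : List A} {B i : ℕ} (hi : i ≤ B) (h : B ≤ l.length ∨ r = []) :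
    l.drop i ++ r = (l ++ r).drop i := by
  rcases h with h | rfl
  · rw [List.drop_append_of_le_length (by omega)]
  · simp

theorem take_eq_of_window {l r : List A} {B : ℕ} (h : B ≤ l.length ∨ r = []) :
    l.take B = (l ++ r).take B := by
  rcases h with h | rfl
  · rw [List.take_append_of_le_length (by omega)]
  · simp

variable [Nonempty A]

/-- The configurations of the machine. -/
abbrev Config : Type := TM2.Cfg (Γ A) Phase (State A Q R.B)

/-- The machine, started in the configuration `x`, is in the configuration `y` after at most `n`
steps. -/
def RunsTo (n : ℕ) (x y : R.Config) : Prop :=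
  ∃ k ≤ n, (flip Bind.bind (TM2.step R.program))^[k] (some x) = some y

variable {R}

theorem RunsTo.refl (x : R.Config) : R.RunsTo 0 x x := ⟨0, le_rfl, rfl⟩

theorem RunsTo.head {n : ℕ} {x y z : R.Config} (h : TM2.step R.program x = some y)
    (h' : R.RunsTo n y z) : R.RunsTo (n + 1) x z := by
  obtain ⟨k, hk, e⟩ := h'
  refine ⟨k + 1, by omega, ?_⟩
  rw [Function.iterate_succ_apply]
  change (flip Bind.bind (TM2.step R.program))^[k] (TM2.step R.program x) = _
  rw [h, e]

theorem RunsTo.mono {n n' : ℕ} {x y : R.Config} (h : R.RunsTo n x y) (hn : n ≤ n') :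
    R.RunsTo n' x y := let ⟨k, hk, e⟩ := h; ⟨k, hk.trans hn, e⟩

theorem runsTo_split {y : R.Config} {n : ℕ} (v : List (Option A)) (s) (u b : List A)
    (h : R.RunsTo n ⟨some .back, .inl (some none), contents v (u.reverse ++ b) [] []⟩ y) :
    R.RunsTo (n + u.length + 1)
      ⟨some .split, s, contents (u.map some ++ none :: v) b [] []⟩ y := by
  induction u generalizing b s with
  | nil =>
    refine .head ?_ h
    simp [program, contents, isLetter]
  | cons a u ih =>
    refine .head ?_ (ih (.inl (some (some a))) (a :: b) (by simpa using h))
    simp [program, contents, isLetter, letterOf]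

theorem runsTo_back {y : R.Config} {n : ℕ} (v : List (Option A)) (s) (b c : List A)
    (h : R.RunsTo n ⟨some .read, R.initial, contents v [] (b.reverse ++ c) []⟩ y) :
    R.RunsTo (n + b.length + 1) ⟨some .back, s, contents v b c []⟩ y := by
  induction b generalizing c s with
  | nil =>
    refine .head ?_ h
    simp [program, contents, isLetter]
  | cons a b ih =>
    refine .head ?_ (ih (.inl (some (some a))) (a :: c) (by simpa using h))
    simp [program, contents, isLetter, letterOf]

theorem runsTo_clean (v : List (Option A)) (b m : Bool) :
    R.RunsTo (v.length + 1) ⟨some .clean, .inr (.inr (b, m)), contents v [] [] []⟩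
      ⟨none, .inl none, contents [] [] [] [b]⟩ := by
  induction v generalizing m with
  | nil =>
    refine .head ?_ (.refl _)
    simp [program, contents, result, more]
  | cons a v ih =>
    refine .head ?_ (ih true)
    simp [program, contents, result, more]

theorem step_read_fst {s : State A Q R.B} (h : needFst s = true) (a b c d) :
    TM2.step R.program ⟨some .read, s, contents a b c d⟩ =
      some ⟨some .read, refillFst s c.head?, contents a b c.tail d⟩ := by
  simp [program, h, contents]

theorem step_read_snd {s : State A Q R.B} (h : needFst s = false) (h' : needSnd s = true)
    (a b c d) : TM2.step R.program ⟨some .read, s, contents a b c d⟩ =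
      some ⟨some .read, refillSnd s a.head?, contents a.tail b c d⟩ := by
  simp [program, h, h', contents]

theorem step_read_finish {s : State A Q R.B} (h : needFst s = false) (h' : needSnd s = false)
    (hd : fstDone s = true) (k : ∀ k, List (Γ A k)) :
    TM2.step R.program ⟨some .read, s, k⟩ = some ⟨some .clean, R.finish s, k⟩ := by
  simp [program, h, h', hd]

theorem step_read_act {s : State A Q R.B} (h : needFst s = false) (h' : needSnd s = false)
    (hd : fstDone s = false) (k : ∀ k, List (Γ A k)) :
    TM2.step R.program ⟨some .read, s, k⟩ = some ⟨some .read, R.act s, k⟩ := by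
  simp [program, h, h', hd]

open Classical in
/-- The reading phase. The number `N` of steps is bounded by weighting a letter that is still on a
stack twice, one in the window of the first word once, and an empty stack that has not been
recognised as such once; what is left of the second word is paid for by the same letters in the
last phase. The predicate `ans q u v` is the answer that is given in the state `q` when the words
`u` and `v` are left. -/
theorem runsTo_read {ans : Q → List A → List A → Prop}
    (hnil : ∀ q v, ans q [] v ↔ v = [] ∧ R.accept q)
    (hcons : ∀ q u v, u ≠ [] → (ans q u v ↔
      ans (R.next q u v).1 (u.drop (R.next q u v).2.1) (v.drop (R.next q u v).2.2)))
    (N : ℕ) (q : Q) (x y : Window A R.B × Bool) (u v : List A)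
    (hx : x.2 = true → u = []) (hy : y.2 = true → v = [])
    (hN : 2 * u.length + x.1.1.length + (!x.2).toNat + 2 * v.length + (!y.2).toNat + 2 ≤ N)
    (b : Bool) (hb : b = true ↔ ans q (x.1.1 ++ u) (y.1.1 ++ v)) :
    R.RunsTo N ⟨some .read, .inr (.inl (q, x, y)), contents (v.map some) [] u []⟩
      ⟨none, .inl none, contents [] [] [] [b]⟩ := by
  induction N generalizing q x y u v b with
  | zero => omega
  | succ N ih =>
    obtain ⟨⟨bu, hbu⟩, eu⟩ := x
    obtain ⟨⟨bv, hbv⟩, ev⟩ := y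
    simp only at hx hy hN hb
    by_cases hf : bu.length < R.B ∧ eu = false
    · obtain ⟨hf, rfl⟩ := hf
      cases u with
      | nil =>
        refine .head ?_ (ih q (⟨bu, hbu⟩, true) (⟨bv, hbv⟩, ev) [] v (by simp) hy ?_ b hb)
        · rw [step_read_fst (by simp [needFst, hf])]
          simp [refillFst, Window.refill]
        · simp at hN ⊢; omega
      | cons a u =>
        refine .head ?_ (ih q (⟨bu ++ [a], by simpa using hf⟩, false) (⟨bv, hbv⟩, ev) u v
          (by simp) hy ?_ b (by simpa using hb))
        · rw [step_read_fst (by simp [needFst, hf])]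
          simp [refillFst, Window.refill, hf]
        · simp at hN ⊢; omega
    · have hfst : needFst (.inr (.inl (q, (⟨bu, hbu⟩, eu), (⟨bv, hbv⟩, ev))) : State A Q R.B)
          = false := by
        cases eu
        · simpa [needFst] using hf
        · simp [needFst]
      have hfu : R.B ≤ bu.length ∨ u = [] := by
        cases eu
        · exact .inl (by simpa using hf)
        · exact .inr (hx rfl)
      by_cases hs : bv.length < R.B ∧ ev = false
      · obtain ⟨hs, rfl⟩ := hs
        cases v with
        | nil =>
          refine .head ?_ (ih q (⟨bu, hbu⟩, eu) (⟨bv, hbv⟩, true) u [] hx (by simp) ?_ b hb)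
          · rw [step_read_snd hfst (by simp [needSnd, hs])]
            simp [refillSnd, Window.refill]
          · simp at hN ⊢; omega
        | cons a v =>
          refine .head ?_ (ih q (⟨bu, hbu⟩, eu) (⟨bv ++ [a], by simpa using hs⟩, false) u v
            hx (by simp) ?_ b (by simpa using hb))
          · rw [step_read_snd hfst (by simp [needSnd, hs])]
            simp [refillSnd, Window.refill, hs]
          · simp at hN ⊢; omega
      · have hsnd : needSnd (.inr (.inl (q, (⟨bu, hbu⟩, eu), (⟨bv, hbv⟩, ev))) : State A Q R.B)
            = false := by
          cases ev
          · simpa [needSnd] using hs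
          · simp [needSnd]
        have hfv : R.B ≤ bv.length ∨ v = [] := by
          cases ev
          · exact .inl (by simpa using hs)
          · exact .inr (hy rfl)
        by_cases hd : bu = []
        · subst hd
          have hu : u = [] := hfu.resolve_left (by have := R.B_pos; simp; omega)
          subst hu
          have hbv' : bv = [] → v = [] := by
            rintro rfl
            exact hfv.resolve_left (by have := R.B_pos; simp; omega)
          refine .head ?_ ((runsTo_clean (v.map some) b true).mono ?_)
          · have : b = decide (bv = [] ∧ R.accept q) := by
              rw [Bool.eq_iff_iff, hb]
              simp only [List.append_nil, hnil, decide_eq_true_eq]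
              constructor
              · rintro ⟨h, h'⟩
                exact ⟨(List.append_eq_nil_iff.1 h).1, h'⟩
              · rintro ⟨h, h'⟩
                exact ⟨by simp [h, hbv' h], h'⟩
            rw [step_read_finish hfst hsnd rfl, this]
            rfl
          · simp at hN ⊢; omega
        · have e : R.next q bu bv = R.next q (bu ++ u) (bv ++ v) := by
            rw [← R.next_take, ← R.next_take q (bu ++ u), take_eq_of_window hfu, take_eq_of_window hfv]
          have hpos := R.fst_pos q bu bv hd
          refine .head ?_ (ih (R.next q bu bv).1 (Window.drop ⟨bu, hbu⟩ (R.next q bu bv).2.1, eu)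
            (Window.drop ⟨bv, hbv⟩ (R.next q bu bv).2.2, ev) u v hx hy ?_ b ?_)
          · rw [step_read_act hfst hsnd (by simpa [fstDone] using hd)]
            rfl
          · have := List.length_pos_iff.2 hd
            simp [Window.drop] at hN ⊢; omega
          · rw [hb, hcons _ _ _ (by simp [hd]), ← e]
            simp only [Window.drop]
            rw [drop_append_of_window (R.fst_le _ _ _) hfu, drop_append_of_window (R.snd_le _ _ _) hfv]

variable (R)

/-- What a reader with finitely many states decides is decided in linear time. -/
theorem decidableInLinearTime [Fintype A] [Finite Q] {ans : Q → List A → List A → Prop}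
    (hnil : ∀ q v, ans q [] v ↔ v = [] ∧ R.accept q)
    (hcons : ∀ q u v, u ≠ [] → (ans q u v ↔
      ans (R.next q u v).1 (u.drop (R.next q u v).2.1) (v.drop (R.next q u v).2.2))) :
    DecidableInLinearTime (fun p : List A × List A => encodeWordPair p)
      (fun p => ans R.start p.1 p.2) := by
  classical
  refine ⟨⟨⟨R.machine, Equiv.refl _, Equiv.refl _⟩, fun n => 6 * (n + 1), fun p => ?_⟩,
    6, fun n => le_rfl⟩
  obtain ⟨u, v⟩ := p
  have key : R.RunsTo (6 * ((encodeWordPair (u, v)).length + 1))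
      ⟨some .split, .inl none, contents (encodeWordPair (u, v)) [] [] []⟩
      ⟨none, .inl none, contents [] [] [] [decide (ans R.start u v)]⟩ := by
    have h1 := runsTo_read (R := R) hnil hcons _ R.start (⟨[], Nat.zero_le _⟩, false)
      (⟨[], Nat.zero_le _⟩, false) u v (by simp) (by simp) le_rfl
      (decide (ans R.start u v)) (by simp)
    have h2 := runsTo_back (R := R) (v.map some) (.inl (some none)) u.reverse []
      (by simpa [initial] using h1)
    refine (runsTo_split (R := R) (v.map some) (.inl none) u [] (by simpa using h2)).mono ?_
    simp [encodeWordPair]; omega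
  have e1 : (Turing.initList R.machine ((encodeWordPair (u, v)).map (Equiv.refl _).invFun))
      = (⟨some .split, .inl none, contents (encodeWordPair (u, v)) [] [] []⟩ : R.Config) := by
    simp only [Turing.initList]
    congr 1
    funext k
    cases k
    · exact List.map_id _
    all_goals rfl
  have e2 : (Turing.haltList R.machine ([decide (ans R.start u v)].map (Equiv.refl _).invFun))
      = (⟨none, .inl none, contents [] [] [] [decide (ans R.start u v)]⟩ : R.Config) := by
    simp only [Turing.haltList]
    congr 1
    funext k
    cases k <;> rfl
  refine ⟨⟨key.choose, ?_⟩, key.choose_spec.1⟩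
  refine Eq.trans ?_ (key.choose_spec.2.trans ?_)
  · exact congrArg (fun z => (flip Bind.bind (TM2.step R.program))^[key.choose] (some z)) e1
  · exact congrArg some e2.symm

end PairReader

namespace SmallOverlap

variable {A S : Type} (D : SmallOverlap A S)

/-! ### Deciding equivalence with a reader -/

/-- Two symbols that can stand in the same place of equivalent marked words. -/
def Paired (x y : A ⊕ S) : Prop := ∃ p, fstSymbol p = x ∧ D.sndSymbol p = y

theorem paired_letters (e e' : A) : D.Paired (.inl e) (.inl e') := ⟨.inl (e, e'), rfl, rfl⟩

theorem paired_refl (x : A ⊕ S) : D.Paired x x := by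
  rcases x with e | s
  · exact D.paired_letters e e
  · exact ⟨.inr (s, false), rfl, by simp [sndSymbol]⟩

theorem paired_bar (s : S) : D.Paired (.inr s) (.inr (D.bar s)) :=
  ⟨.inr (s, true), rfl, by simp [sndSymbol]⟩

theorem Paired.trans {D : SmallOverlap A S} {x y z : A ⊕ S} (h : D.Paired x y)
    (h' : D.Paired y z) : D.Paired x z := by
  obtain ⟨p, rfl, rfl⟩ := h
  obtain ⟨q, hq, rfl⟩ := h'
  rcases p with ⟨e, e'⟩ | ⟨s, b⟩ <;> rcases q with ⟨i, i'⟩ | ⟨r, b'⟩ <;>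
    simp only [fstSymbol, sndSymbol, reduceCtorEq, Sum.inr.injEq] at hq
  · exact D.paired_letters _ _
  · subst hq
    cases b <;> cases b' <;>
      simp [fstSymbol, sndSymbol, D.bar_bar, D.paired_refl, D.paired_bar]

theorem forall₂_paired_letters {y y' : List A} (h : y.length = y'.length) :
    List.Forall₂ D.Paired (y.map .inl) (y'.map .inl) := by
  induction y generalizing y' with
  | nil => cases y' <;> simp_all
  | cons e y ih =>
    cases y' with
    | nil => simp at h
    | cons e' y' => exact .cons (D.paired_letters e e') (ih (by simpa using h))

theorem forall₂_paired_refl (κ : List (A ⊕ S)) : List.Forall₂ D.Paired κ κ :=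
  List.forall₂_same.2 fun x _ => D.paired_refl x

theorem forall₂_paired_trans {κ κ' κ'' : List (A ⊕ S)} (h : List.Forall₂ D.Paired κ κ')
    (h' : List.Forall₂ D.Paired κ' κ'') : List.Forall₂ D.Paired κ κ'' := by
  induction h generalizing κ'' with
  | nil => exact h'
  | cons h _ ih =>
    cases h' with
    | cons h₁ h₂ => exact .cons (h.trans h₁) (ih h₂)

theorem MReach.paired {D : SmallOverlap A S} {κ κ' : List (A ⊕ S)} (h : D.MReach κ κ') :
    List.Forall₂ D.Paired κ κ' := by
  induction h with
  | refl => exact D.forall₂_paired_refl κ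
  | tail _ h ih =>
    refine D.forall₂_paired_trans ih ?_
    obtain ⟨α, β, s, rfl, rfl⟩ := h
    refine List.rel_append (D.forall₂_paired_refl α) (List.rel_append ?_ (D.forall₂_paired_refl β))
    exact List.rel_append (D.forall₂_paired_letters (by simp [length_X]))
      (.cons (D.paired_bar s) (D.forall₂_paired_letters (by simp [length_Z])))

theorem exists_symbolPairs {κ κ' : List (A ⊕ S)} (h : List.Forall₂ D.Paired κ κ') :
    ∃ l : List (SymbolPair A S), l.map fstSymbol = κ ∧ l.map D.sndSymbol = κ' := by
  induction h with
  | nil => exact ⟨[], rfl, rfl⟩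
  | cons h _ ih =>
    obtain ⟨p, rfl, rfl⟩ := h
    obtain ⟨l, rfl, rfl⟩ := ih
    exact ⟨p :: l, rfl, rfl⟩

/-- What remains to be found out about the rest of two words that are being read, in terms of the
profile of the rest. -/
abbrev Demand : Type := (D.Question → Prop) → Prop

/-- The words `u` and `v` can be read as a pair of marked words, the first of them the parse of `u`,
whose profile satisfies `G`. -/
def Answer (G : D.Demand) (u v : List A) : Prop :=
  ∃ l : List (SymbolPair A S), D.Parse u (l.map fstSymbol) ∧ D.word (l.map D.sndSymbol) = v ∧
    G (D.profile l)

/-- The demand on the rest when `ps` has been read and the demand on the whole is `G`. -/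
def behind (ps : List (SymbolPair A S)) (G : D.Demand) : D.Demand :=
  fun f => ∃ l, D.profile l = f ∧ G (D.profile (ps ++ l))

theorem behind_profile (ps l : List (SymbolPair A S)) (G : D.Demand) :
    D.behind ps G (D.profile l) ↔ G (D.profile (ps ++ l)) := by
  have key (l' : List (SymbolPair A S)) (h : D.profile l' = D.profile l) :
      D.profile (ps ++ l') = D.profile (ps ++ l) := by
    induction ps with
    | nil => exact h
    | cons p ps ih => exact D.profile_cons_congr ih p
  exact ⟨fun ⟨l', h, hG⟩ => key l' h ▸ hG, fun h => ⟨l, rfl, h⟩⟩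

/-- The demand that the two marked words are equivalent. -/
def equivalenceDemand : D.Demand := fun f => f (.inl (⟨[], Nat.zero_le _⟩, none, none))

theorem answer_iff_reach (u v : List A) :
    D.Answer D.equivalenceDemand u v ↔ Relation.ReflTransGen D.Step u v := by
  have e (l : List (SymbolPair A S)) : D.equivalenceDemand (D.profile l) ↔
      D.MReach (l.map fstSymbol) (l.map D.sndSymbol) := by
    simpa [equivalenceDemand, profile] using D.hreach_none
  constructor
  · rintro ⟨l, hp, hw, hG⟩
    exact (D.reach_iff hp).2 ⟨_, (e l).1 hG, hw⟩
  · intro h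
    obtain ⟨κ₀, hp⟩ := D.exists_parse u
    obtain ⟨κ, hr, hw⟩ := (D.reach_iff hp).1 h
    obtain ⟨l, rfl, rfl⟩ := D.exists_symbolPairs hr.paired
    exact ⟨l, hp, hw, (e l).2 hr⟩

theorem answer_nil (G : D.Demand) (v : List A) :
    D.Answer G [] v ↔ v = [] ∧ G (D.profile []) := by
  constructor
  · rintro ⟨l, hp, hw, hG⟩
    have hl : l = [] := by
      cases l with
      | nil => rfl
      | cons p l =>
        have := hp.word_eq
        rcases p with ⟨e, e'⟩ | ⟨s, b⟩
        · simp [fstSymbol] at this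
        · have h1 := congrArg List.length this
          have h2 := D.length_M_ge s
          have h3 := D.m_pos
          simp [fstSymbol] at h1
          simp [h1] at h2
          omega
    subst hl
    exact ⟨by simpa using hw.symm, hG⟩
  · rintro ⟨rfl, hG⟩
    exact ⟨[], .nil, rfl, hG⟩

/-- Reading a letter of the first word that is not at the beginning of some `H t`. -/
theorem answer_letter (G : D.Demand) {e : A} {u : List A} (h : ∀ t, ¬ D.H t <+: e :: u)
    (v : List A) : D.Answer G (e :: u) v ↔
      ∃ e' v', v = e' :: v' ∧ D.Answer (D.behind [.inl (e, e')] G) u v' := by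
  constructor
  · rintro ⟨l, hp, rfl, hG⟩
    generalize hx : e :: u = x at hp
    generalize hκ : l.map fstSymbol = κ at hp
    cases hp with
    | nil => simp at hx
    | letter _ hp =>
      simp only [List.cons.injEq] at hx
      obtain ⟨rfl, rfl⟩ := hx
      rw [List.map_eq_cons_iff] at hκ
      obtain ⟨p, l, rfl, hp', rfl⟩ := hκ
      rcases p with ⟨i, e'⟩ | ⟨s, b⟩ <;> simp only [fstSymbol, reduceCtorEq, Sum.inl.injEq] at hp'
      subst hp'
      exact ⟨e', _, by simp [sndSymbol], l, hp, rfl, (D.behind_profile _ l G).2 hG⟩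
    | @marker t =>
      refine absurd ?_ (h t)
      rw [hx, H]
      simp
  · rintro ⟨e', v', rfl, l, hp, rfl, hG⟩
    exact ⟨.inl (e, e') :: l, .letter h hp, by simp [sndSymbol], (D.behind_profile _ l G).1 hG⟩

theorem exists_letterPairs {l : List (SymbolPair A S)} {y : List A}
    (h : l.map fstSymbol = y.map .inl) :
    ∃ ps : List (A × A), l = ps.map .inl ∧ ps.map Prod.fst = y := by
  induction l generalizing y with
  | nil => exact ⟨[], rfl, by simpa using h.symm⟩
  | cons p l ih =>
    cases y with
    | nil => simp at h
    | cons e y =>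
      simp only [List.map_cons, List.cons.injEq] at h
      obtain ⟨ps, rfl, rfl⟩ := ih h.2
      rcases p with p | p <;> simp only [fstSymbol, reduceCtorEq, Sum.inl.injEq, false_and] at h
      exact ⟨p :: ps, rfl, by simp [h.1]⟩

theorem fst_letterPairs (ps : List (A × A)) :
    (ps.map (Sum.inl : A × A → SymbolPair A S)).map fstSymbol = (ps.map Prod.fst).map .inl := by
  simp [fstSymbol, Function.comp_def]

theorem snd_letterPairs (ps : List (A × A)) :
    (ps.map (Sum.inl : A × A → SymbolPair A S)).map D.sndSymbol = (ps.map Prod.snd).map .inl := by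
  simp [sndSymbol, Function.comp_def]

/-- The marker `s`, or the other one of its pair. -/
def choice (s : S) (b : Bool) : S := if b then D.bar s else s

theorem choice_injective (s : S) : Function.Injective (D.choice s) := by
  intro b b' h
  have h1 := D.bar_ne s
  cases b <;> cases b' <;> simp_all [choice, eq_comm]

/-- Reading up to the end of the core of `t` when the first word starts with `H t`. -/
theorem answer_marker (G : D.Demand) (t : S) (u v : List A) :
    D.Answer G (D.X₂ t ++ (D.M t ++ (D.Z₁ t ++ u))) v ↔
      ∃ b y v', v = y ++ (D.M (D.choice t b) ++ v') ∧ y.length = 2 * D.m ∧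
        D.Answer (D.behind (((D.X₂ t).zip y).map .inl ++ [.inr (t, b)]) G) (D.Z₁ t ++ u) v' := by
  constructor
  · rintro ⟨l, hp, rfl, hG⟩
    have hH : D.H t <+: D.X₂ t ++ (D.M t ++ (D.Z₁ t ++ u)) := by simp [H]
    generalize hx : D.X₂ t ++ (D.M t ++ (D.Z₁ t ++ u)) = x at hp hH
    generalize hκ : l.map fstSymbol = κ at hp
    cases hp with
    | nil =>
      have h1 := congrArg List.length hx
      have h2 := D.m_pos
      simp [length_X₂] at h1
      omega
    | letter h => exact absurd hH (h t)
    | @marker s u' κ hp =>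
      obtain rfl := D.H_inj hH (t := s) (by simp [H])
      simp only [List.append_cancel_left_eq] at hx
      subst hx
      rw [List.map_eq_append_iff] at hκ
      obtain ⟨l₁, l, rfl, h₁, h₂⟩ := hκ
      rw [List.map_eq_cons_iff] at h₂
      obtain ⟨p, l, rfl, hp', rfl⟩ := h₂
      obtain ⟨ps, rfl, hps⟩ := exists_letterPairs h₁
      rcases p with p | ⟨s, b⟩ <;> simp only [fstSymbol, reduceCtorEq, Sum.inr.injEq] at hp'
      subst hp'
      refine ⟨b, ps.map Prod.snd, _, ?_, ?_, l, hp, rfl, (D.behind_profile _ l G).2 ?_⟩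
      · simp only [List.map_append, List.map_cons, snd_letterPairs, word_append, word_letters,
          sndSymbol, word_inr, choice]
      · rw [List.length_map, ← List.length_map (f := Prod.fst), hps, length_X₂]
      · rw [← List.zip_of_prod hps rfl]
        simpa using hG
  · rintro ⟨b, y, v', rfl, hy, l, hp, rfl, hG⟩
    have hl : (D.X₂ t).length = y.length := by rw [length_X₂, hy]
    refine ⟨((D.X₂ t).zip y).map .inl ++ .inr (t, b) :: l, ?_, ?_, ?_⟩
    · rw [List.map_append, fst_letterPairs, List.map_fst_zip hl.le]
      exact .marker hp
    · rw [List.map_append, snd_letterPairs, List.map_snd_zip hl.ge]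
      simp [sndSymbol, choice]
    · simpa using (D.behind_profile _ l G).1 hG

open Classical in
/-- Some element with the property `p`, if there is one. -/
noncomputable def pick {ι : Type} (p : ι → Prop) : Option ι :=
  if h : ∃ i, p i then some h.choose else none

theorem pick_cases {ι : Type} (p : ι → Prop) :
    (∃ i, p i ∧ pick p = some i) ∨ ((∀ i, ¬ p i) ∧ pick p = none) := by
  by_cases h : ∃ i, p i
  · exact .inl ⟨h.choose, h.choose_spec, by rw [pick, dif_pos h]⟩
  · exact .inr ⟨not_exists.1 h, by rw [pick, dif_neg h]⟩

/-- The next step in reading two words: behind `X₂ t` and the core of `t` if the first word starts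
with `H t`, and behind a letter otherwise. If there is nothing corresponding to it in the second
word, the demand becomes unsatisfiable. -/
noncomputable def next (G : D.Demand) (u v : List A) : D.Demand × ℕ × ℕ :=
  match pick fun t => D.H t <+: u with
  | some t =>
    match pick fun b => 2 * D.m ≤ v.length ∧ D.M (D.choice t b) <+: v.drop (2 * D.m) with
    | some b => (D.behind (((D.X₂ t).zip (v.take (2 * D.m))).map .inl ++ [.inr (t, b)]) G,
        2 * D.m + (D.M t).length, 2 * D.m + (D.M (D.choice t b)).length)
    | none => (fun _ => False, 1, 0)
  | none =>
    match u.head?, v.head? with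
    | some e, some e' => (D.behind [.inl (e, e')] G, 1, 1)
    | _, _ => (fun _ => False, 1, 0)

theorem not_answer_false (u v : List A) : ¬ D.Answer (fun _ => False) u v :=
  fun ⟨_, _, _, h⟩ => h

/-- The steps of the reader preserve the answer. -/
theorem answer_next (G : D.Demand) {u : List A} (hu : u ≠ []) (v : List A) :
    D.Answer G u v ↔ D.Answer (D.next G u v).1 (u.drop (D.next G u v).2.1)
      (v.drop (D.next G u v).2.2) := by
  rcases pick_cases fun t => D.H t <+: u with ⟨t, ht, e⟩ | ⟨h, e⟩
  · obtain ⟨u, rfl⟩ := ht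
    have hu' : D.H t ++ u = D.X₂ t ++ (D.M t ++ (D.Z₁ t ++ u)) := by simp [H]
    have hX := D.length_X₂ t
    rw [next, e]
    dsimp only
    rcases pick_cases fun b => 2 * D.m ≤ v.length ∧ D.M (D.choice t b) <+: v.drop (2 * D.m) with
      ⟨b, ⟨hv, v', hb⟩, e'⟩ | ⟨h', e'⟩
    · rw [e']
      dsimp only
      rw [hu', answer_marker, ← hX, ← List.length_append, ← List.append_assoc, List.drop_left, hX,
        ← List.drop_drop, ← hb, List.drop_left]
      have hv' : v = v.take (2 * D.m) ++ (D.M (D.choice t b) ++ v') := by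
        rw [hb, List.take_append_drop]
      constructor
      · rintro ⟨b', y, v'', hv'', hy, hA⟩
        have h1 : v.take (2 * D.m) = y := by
          rw [hv'', List.take_append_of_le_length hy.ge, ← hy, List.take_length]
        have h2 : D.M (D.choice t b') ++ v'' = D.M (D.choice t b) ++ v' := by
          rw [hb, hv'', List.drop_append_of_le_length hy.ge, ← hy, List.drop_length,
            List.nil_append]
        obtain rfl : b' = b := D.choice_injective t <|
          D.eq_of_M_prefix (w := D.M (D.choice t b') ++ v'') (List.prefix_append _ _)
            (h2 ▸ List.prefix_append _ _)
        rw [h1, ← List.append_cancel_left h2]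
        exact hA
      · intro hA
        exact ⟨b, v.take (2 * D.m), v', hv', by simpa using hv, hA⟩
    · rw [e']
      dsimp only
      refine iff_of_false ?_ (D.not_answer_false _ _)
      rw [hu', answer_marker]
      rintro ⟨b, y, v', rfl, hy, -⟩
      refine h' b ⟨by simp; omega, ?_⟩
      rw [← hy, List.drop_left]
      exact List.prefix_append _ _
  · cases u with
    | nil => exact absurd rfl hu
    | cons i u =>
      rw [next, e, D.answer_letter G h]
      cases v with
      | nil => simp [not_answer_false]
      | cons i' v => simp

theorem length_H_le (s : S) : (D.H s).length ≤ (D.rel s).length := by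
  rw [D.rel_eq_H s, List.length_append, List.length_append]
  omega

theorem length_core_le (s : S) : 2 * D.m + (D.M s).length ≤ (D.rel s).length := by
  have := D.long s
  rw [length_M]; omega

/-- The look-ahead of the reader is bounded. -/
theorem next_take {B : ℕ} (hB : ∀ s, (D.rel s).length ≤ B) (hB' : 0 < B) (G : D.Demand)
    (u v : List A) : D.next G (u.take B) (v.take B) = D.next G u v := by
  have hH : ∀ t, D.H t <+: u.take B ↔ D.H t <+: u := fun t => by
    rw [List.prefix_take_iff]
    exact and_iff_left ((D.length_H_le t).trans (hB t))
  rcases pick_cases fun t => D.H t <+: u with ⟨t, ht, e⟩ | ⟨h, e⟩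
  · have h2 : 2 * D.m ≤ B := by
      have := D.length_core_le t
      have := hB t
      omega
    have hM : ∀ b, (2 * D.m ≤ (v.take B).length ∧
        D.M (D.choice t b) <+: (v.take B).drop (2 * D.m)) ↔
        (2 * D.m ≤ v.length ∧ D.M (D.choice t b) <+: v.drop (2 * D.m)) := fun b => by
      have h3 := D.length_core_le (D.choice t b)
      have h4 := hB (D.choice t b)
      rw [List.drop_take, List.prefix_take_iff, List.length_take,
        and_iff_left (a := _ <+: _) (by omega)]
      exact and_congr_left fun _ => by omega
    simp only [next, hH, e, hM, List.take_take, min_eq_left h2]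
  · obtain ⟨B, rfl⟩ : ∃ B', B = B' + 1 := ⟨B - 1, by omega⟩
    simp only [next, hH, e]
    cases u <;> cases v <;> rfl

theorem next_pos (G : D.Demand) (u v : List A) : 0 < (D.next G u v).2.1 := by
  have := D.m_pos
  unfold next
  split
  · split
    · simp; omega
    · simp
  · split <;> simp

theorem next_le {B : ℕ} (hB : ∀ s, (D.rel s).length ≤ B) (hB' : 0 < B) (G : D.Demand)
    (u v : List A) : (D.next G u v).2.1 ≤ B ∧ (D.next G u v).2.2 ≤ B := by
  unfold next
  split
  · split
    · exact ⟨(D.length_core_le _).trans (hB _), (D.length_core_le _).trans (hB _)⟩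
    · exact ⟨hB', Nat.zero_le _⟩
  · split
    · exact ⟨hB', hB'⟩
    · exact ⟨hB', Nat.zero_le _⟩

theorem length_rel_le [Fintype S] (s : S) : (D.rel s).length ≤ ∑ s, (D.rel s).length + 1 :=
  (Finset.single_le_sum (f := fun s => (D.rel s).length) (fun _ _ => Nat.zero_le _)
    (Finset.mem_univ s)).trans (Nat.le_succ _)

/-- The reader that decides whether two words are equivalent. -/
noncomputable def reader [Fintype S] : PairReader A D.Demand where
  B := ∑ s, (D.rel s).length + 1
  B_pos := Nat.succ_pos _
  start := D.equivalenceDemand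
  next := D.next
  accept G := G (D.profile [])
  next_take := D.next_take D.length_rel_le (Nat.succ_pos _)
  fst_le G u v := (D.next_le D.length_rel_le (Nat.succ_pos _) G u v).1
  snd_le G u v := (D.next_le D.length_rel_le (Nat.succ_pos _) G u v).2
  fst_pos G u v _ := D.next_pos G u v

/-- Equivalence is decided in linear time. -/
theorem decidableInLinearTime [Fintype A] [Nonempty A] [Fintype S] :
    DecidableInLinearTime (fun p : List A × List A => encodeWordPair p)
      (fun p => Relation.ReflTransGen D.Step p.1 p.2) := by
  have h1 (n : ℕ) : Finite {y : List A // y.length ≤ n} :=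
    (List.finite_length_le A n).to_subtype
  have h2 (n : ℕ) : Finite {y : List (A × A) // y.length ≤ n} :=
    (List.finite_length_le (A × A) n).to_subtype
  have := D.reader.decidableInLinearTime (ans := D.Answer) D.answer_nil
    (fun G u v hu => D.answer_next G hu v)
  simpa only [reader, answer_iff_reach] using this

end SmallOverlap

/-! ### Counting families of words -/

namespace WordFamily

open Function

variable {A ι : Type}

/-- The words all have length at least `20 * m`, and no two different factors of length `m` of the
family are equal. -/
def WellSpread (m : ℕ) (w : ι → List A) : Prop :=
  (∀ s, 20 * m ≤ (w s).length) ∧ ∀ s s' a a', a + m ≤ (w s).length → a' + m ≤ (w s').length →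
    ((w s).drop a).take m = ((w s').drop a').take m → s = s' ∧ a = a'

/-- The families of words whose lengths belong to `L`. -/
def ofLengths (A : Type) (L : Set (ι → ℕ)) : Set (ι → List A) := {w | (fun i => (w i).length) ∈ L}

/-- The families in `T` with equal factors of length `m` at two given places. -/
def Repeating (T : Set (ι → List A)) (m : ℕ) (s : ι) (a : ℕ) (s' : ι) (a' : ℕ) :
    Set (ι → List A) :=
  {w ∈ T | a + m ≤ (w s).length ∧ a' + m ≤ (w s').length ∧
    ((w s).drop a).take m = ((w s').drop a').take m}

/-- The word `l` with its factor of the length of `g` at position `a` replaced by `g`. -/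
def splice (l : List A) (a : ℕ) (g : List A) : List A := l.take a ++ (g ++ l.drop (a + g.length))

theorem length_splice {l : List A} {a : ℕ} {g : List A} (h : a + g.length ≤ l.length) :
    (splice l a g).length = l.length := by
  simp [splice]; omega

theorem take_drop_splice {l : List A} {a : ℕ} {g : List A} (h : a ≤ l.length) :
    ((splice l a g).drop a).take g.length = g := by
  have e : (l.take a).length = a := by simpa using h
  rw [splice]
  conv_lhs => enter [2, 1]; rw [← e]
  rw [List.drop_left, List.take_left]

theorem getElem?_splice {l : List A} {a : ℕ} {g : List A} (h : a ≤ l.length) {j : ℕ}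
    (hj : j < a ∨ a + g.length ≤ j) : (splice l a g)[j]? = l[j]? := by
  rw [splice]
  rcases hj with hj | hj
  · rw [List.getElem?_append_left (by simp; omega), List.getElem?_take_of_lt hj]
  · rw [List.getElem?_append_right (by simp; omega), List.getElem?_append_right (by simp; omega),
      List.getElem?_drop]
    congr 1
    simp; omega

theorem getElem?_of_take_drop_eq {l l' : List A} {a a' m j : ℕ}
    (h : (l.drop a).take m = (l'.drop a').take m) (hj : j < m) : l[a + j]? = l'[a' + j]? := by
  have := congrArg (fun x => x[j]?) h
  simpa [List.getElem?_take_of_lt hj] using this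

/-- The families in `T` in which the word `s` is shorter than `K` and the word `i` longer than `N`. -/
def Short (T : Set (ι → List A)) (K N : ℕ) (s i : ι) : Set (ι → List A) :=
  {w ∈ T | (w s).length < K ∧ N < (w i).length}

theorem ncard_short_mul (T : Set (ι → List A)) (K N R : ℕ) (s i : ι) :
    ((Short T K N s i) ×ˢ (Set.univ : Set (Fin R))).ncard = (Short T K N s i).ncard * R := by
  rw [Set.ncard_prod, Set.ncard_univ, Nat.card_eq_fintype_card, Fintype.card_fin]

theorem eq_of_mul_add {K c c' x x' : ℕ} (hx : x < K) (hx' : x' < K)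
    (h : x + c * K = x' + c' * K) : x = x' ∧ c = c' := by
  have h1 := congrArg (· % K) h
  have h2 := congrArg (· / K) h
  simp only [Nat.add_mul_mod_self_right, Nat.mod_eq_of_lt hx, Nat.mod_eq_of_lt hx'] at h1
  simp only [Nat.add_mul_div_right _ _ (Nat.zero_lt_of_lt hx), Nat.div_eq_of_lt hx,
    Nat.div_eq_of_lt hx', zero_add] at h2
  exact ⟨h1, h2⟩

variable [DecidableEq ι]

/-- A repeated factor is determined by the other letters of the family, so that there are many
families for each one with a repetition in a given place: the later factor can be replaced by any
word. -/
theorem ncard_repeating_mul_le [Fintype A] {L : Set (ι → ℕ)} (hT : (ofLengths A L).Finite)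
    {m : ℕ} {s s' : ι} {a a' : ℕ} (hne : s = s' → a < a') :
    (Repeating (ofLengths A L) m s a s' a').ncard * Fintype.card A ^ m ≤ (ofLengths A L).ncard := by
  have h1 : ((Repeating (ofLengths A L) m s a s' a') ×ˢ (Set.univ : Set (Fin m → A))).ncard =
      (Repeating (ofLengths A L) m s a s' a').ncard * Fintype.card A ^ m := by
    rw [Set.ncard_prod, Set.ncard_univ, Nat.card_eq_fintype_card, Fintype.card_fun,
      Fintype.card_fin]
  rw [← h1]
  refine Set.ncard_le_ncard_of_injOn
    (fun p => update p.1 s' (splice (p.1 s') a' (List.ofFn p.2))) ?_ ?_ hT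
  · rintro ⟨w, g⟩ ⟨⟨hw, -, hl, -⟩, -⟩
    suffices (fun i => (update w s' (splice (w s') a' (List.ofFn g)) i).length) =
        fun i => (w i).length by
      change _ ∈ L
      rw [this]
      exact hw
    funext i
    by_cases hi : i = s'
    · subst hi
      rw [update_self, length_splice (by simpa using hl)]
    · rw [update_of_ne hi]
  · rintro ⟨w, g⟩ ⟨⟨-, hl₁, hl, hr⟩, -⟩ ⟨w', g'⟩ ⟨⟨-, hl₁', hl', hr'⟩, -⟩ h
    simp only at hl₁ hl hr hl₁' hl' hr' h
    have hoff : ∀ i ≠ s', w i = w' i := fun i hi => by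
      simpa [update_of_ne hi] using congrFun h i
    have hs' : splice (w s') a' (List.ofFn g) = splice (w' s') a' (List.ofFn g') := by
      simpa using congrFun h s'
    have hout : ∀ j, j < a' ∨ a' + m ≤ j → (w s')[j]? = (w' s')[j]? := fun j hj => by
      rw [← getElem?_splice (l := w s') (a := a') (g := List.ofFn g) (by omega) (by simpa using hj), hs',
        getElem?_splice (by omega) (by simpa using hj)]
    have hin : ∀ j < m, (w s')[a' + j]? = (w' s')[a' + j]? := fun j => by
      induction j using Nat.strong_induction_on with
      | _ j ih =>
        intro hj
        rw [← getElem?_of_take_drop_eq hr hj, ← getElem?_of_take_drop_eq hr' hj]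
        by_cases hs : s = s'
        · subst hs
          have := hne rfl
          by_cases hj' : a + j < a'
          · exact hout _ (.inl hj')
          · have := ih (a + j - a') (by omega) (by omega)
            rwa [show a' + (a + j - a') = a + j by omega] at this
        · rw [hoff s hs]
    have hw : w = w' := by
      funext i
      by_cases hi : i = s'
      · subst hi
        refine List.ext_getElem? fun j => ?_
        by_cases hj : j < a' ∨ a' + m ≤ j
        · exact hout j hj
        · have := hin (j - a') (by omega)
          rwa [show a' + (j - a') = j by omega] at this
      · exact hoff i hi
    have hg : List.ofFn g = List.ofFn g' := by
      have e := take_drop_splice (l := w s') (a := a') (g := List.ofFn g) (by omega)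
      have e' := take_drop_splice (l := w' s') (a := a') (g := List.ofFn g') (by omega)
      rw [List.length_ofFn] at e e'
      rw [← e, hs', e']
    rw [hw, List.ofFn_injective hg]

/-- There are many families for each one in which the word `s` is short and another one long: a
multiple of `K` letters can be moved from the end of the long one to the end of the short one. -/
theorem ncard_short_mul_le_of_move {L : Set (ι → ℕ)} (hT : (ofLengths A L).Finite) {K R : ℕ}
    {s i : ι} (hsi : s ≠ i) (hL : ∀ ℓ ∈ L, ∀ d < ℓ i,
      update (update ℓ s (ℓ s + d)) i (ℓ i - d) ∈ L) :
    (Short (ofLengths A L) K (R * K) s i).ncard * R ≤ (ofLengths A L).ncard := by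
  rw [← ncard_short_mul]
  have hlt {w : ι → List A} (hl : R * K < (w i).length) (c : Fin R) :
      c.1 * K < (w i).length := (Nat.mul_le_mul_right K c.2.le).trans_lt hl
  refine Set.ncard_le_ncard_of_injOn (fun p => update (update p.1 s
    (p.1 s ++ (p.1 i).drop ((p.1 i).length - p.2.1 * K))) i
      ((p.1 i).take ((p.1 i).length - p.2.1 * K))) ?_ ?_ hT
  · rintro ⟨w, c⟩ ⟨⟨hw, -, hl⟩, -⟩
    have hc := hlt hl c
    have := hL _ hw (c.1 * K) hc
    change (fun j => _) ∈ L
    convert this using 1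
    funext j
    by_cases hj : j = i
    · subst hj
      simp
    · rw [update_of_ne hj, update_of_ne hj]
      by_cases hj' : j = s
      · subst hj'
        simp only [update_self, List.length_append, List.length_drop]
        simp only at hc
        omega
      · rw [update_of_ne hj', update_of_ne hj']
  · rintro ⟨w, c⟩ ⟨⟨-, hs, hl⟩, -⟩ ⟨w', c'⟩ ⟨⟨-, hs', hl'⟩, -⟩ h
    simp only at hs hl hs' hl' h
    have hc := hlt hl c
    have hc' := hlt hl' c'
    have h1 : w s ++ (w i).drop ((w i).length - c.1 * K) =
        w' s ++ (w' i).drop ((w' i).length - c'.1 * K) := by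
      simpa [update_of_ne hsi] using congrFun h s
    have h2 : (w i).take ((w i).length - c.1 * K) = (w' i).take ((w' i).length - c'.1 * K) := by
      simpa using congrFun h i
    obtain ⟨h3, h4⟩ := eq_of_mul_add hs hs' (c := c) (c' := c') (by
      have := congrArg List.length h1
      simp at this
      omega)
    obtain ⟨h5, h6⟩ := List.append_inj h1 h3
    have hw : w = w' := by
      funext j
      by_cases hj : j = i
      · subst hj
        rw [← List.take_append_drop ((w j).length - c.1 * K) (w j), h2, h6,
          List.take_append_drop]
      · by_cases hj' : j = s
        · rw [hj', h5]
        · simpa [update_of_ne hj, update_of_ne hj'] using congrFun h j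
    rw [hw, Fin.ext h4]

/-- There are many families for each one in which the word `s` is short: a power of a fixed letter
can be appended to it. -/
theorem ncard_short_mul_le_of_append [Nonempty A] {L : Set (ι → ℕ)} (hT : (ofLengths A L).Finite)
    {K R : ℕ} {s i : ι} (hL : ∀ ℓ ∈ L, ∀ d, ℓ s + d < R * K → update ℓ s (ℓ s + d) ∈ L) :
    (Short (ofLengths A L) K (R * K) s i).ncard * R ≤ (ofLengths A L).ncard := by
  rw [← ncard_short_mul]
  refine Set.ncard_le_ncard_of_injOn (fun p => update p.1 s
    (p.1 s ++ List.replicate (p.2.1 * K) (Classical.arbitrary A))) ?_ ?_ hT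
  · rintro ⟨w, c⟩ ⟨⟨hw, hs, hl⟩, -⟩
    have := hL _ hw (c.1 * K) (by
      have := Nat.mul_le_mul_right K (show c.1 + 1 ≤ R from c.2)
      simp only at hs ⊢
      linarith)
    change (fun j => _) ∈ L
    convert this using 1
    funext j
    by_cases hj : j = s
    · subst hj
      simp
    · rw [update_of_ne hj, update_of_ne hj]
  · rintro ⟨w, c⟩ ⟨⟨-, hs, hl⟩, -⟩ ⟨w', c'⟩ ⟨⟨-, hs', hl'⟩, -⟩ h
    simp only at hs hl hs' hl' h
    have h1 : w s ++ List.replicate (c.1 * K) (Classical.arbitrary A) =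
        w' s ++ List.replicate (c'.1 * K) (Classical.arbitrary A) := by
      simpa using congrFun h s
    obtain ⟨h3, h4⟩ := eq_of_mul_add hs hs' (c := c) (c' := c') (by
      simpa using congrArg List.length h1)
    have hw : w = w' := by
      funext j
      by_cases hj : j = s
      · rw [hj, (List.append_inj h1 h3).1]
      · simpa [update_of_ne hj] using congrFun h j
    rw [hw, Fin.ext h4]

/-- Classes of length vectors of size `n`, for all `n`, in which one entry is comparable to `n`, and
in which a small entry can be increased, at the cost of a large one or of none. -/
structure LengthClass (ι : Type) [Fintype ι] [DecidableEq ι] where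
  L : ℕ → Set (ι → ℕ)
  le : ∀ n, ∀ ℓ ∈ L n, ∀ i, ℓ i ≤ n
  large : ∀ n, ∀ ℓ ∈ L n, ∃ i, n ≤ Fintype.card ι * ℓ i
  extend : (∀ n, ∀ ℓ ∈ L n, ∀ s i d, s ≠ i → d < ℓ i →
      update (update ℓ s (ℓ s + d)) i (ℓ i - d) ∈ L n) ∨
    (∀ n, ∀ ℓ ∈ L n, ∀ s d, ℓ s + d < n → update ℓ s (ℓ s + d) ∈ L n)
  nonempty : ∀ᶠ n in atTop, (L n).Nonempty

namespace LengthClass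

variable [Fintype ι] (C : LengthClass ι)

/-- The families of size `n`. -/
def level (A : Type) (n : ℕ) : Set (ι → List A) := ofLengths A (C.L n)

theorem finite_level [Finite A] (n : ℕ) : (C.level A n).Finite :=
  (Set.Finite.pi' fun _ : ι => List.finite_length_le A n).subset fun _ hw i => C.le n _ hw i

theorem ncard_level_pos [Finite A] [Nonempty A] :
    ∀ᶠ n in atTop, 0 < (C.level A n).ncard := by
  filter_upwards [C.nonempty] with n ⟨ℓ, hℓ⟩
  refine (Set.ncard_pos (C.finite_level n)).2 ⟨fun i => List.replicate (ℓ i)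
    (Classical.arbitrary A), ?_⟩
  change (fun i => _) ∈ C.L n
  simpa using hℓ

theorem ncard_short_mul_le [Finite A] [Nonempty A] {n K R : ℕ} (h : R * K ≤ n) {s i : ι}
    (hsi : s ≠ i) :
    (Short (C.level A n) K (R * K) s i).ncard * R ≤ (C.level A n).ncard := by
  rcases C.extend with hL | hL
  · exact ncard_short_mul_le_of_move (C.finite_level n) hsi fun ℓ hℓ d hd =>
      hL n ℓ hℓ s i d hsi hd
  · exact ncard_short_mul_le_of_append (C.finite_level n) fun ℓ hℓ d hd =>
      hL n ℓ hℓ s d (hd.trans_le h)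

/-- A family that is not well spread has a word that is short or a factor that is repeated. -/
theorem level_diff_subset {n m R : ℕ} (hR : 0 < R)
    (h : Fintype.card ι * (R * (20 * m)) < n) :
    C.level A n \ {w | WellSpread m w} ⊆
      (⋃ p ∈ {p : ι × ι | p.1 ≠ p.2}, Short (C.level A n) (20 * m) (R * (20 * m)) p.1 p.2) ∪
      ⋃ p ∈ {p : (ι × Fin (n + 1)) × (ι × Fin (n + 1)) | p.1.1 = p.2.1 → p.1.2.1 < p.2.2.1},
        Repeating (C.level A n) m p.1.1 p.1.2 p.2.1 p.2.2 := by
  rintro w ⟨hw, hns⟩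
  simp only [Set.mem_union, Set.mem_iUnion]
  by_cases hl : ∀ s, 20 * m ≤ (w s).length
  · have : ∃ s s' a a', a + m ≤ (w s).length ∧ a' + m ≤ (w s').length ∧
        ((w s).drop a).take m = ((w s').drop a').take m ∧ ¬ (s = s' ∧ a = a') := by
      by_contra hc
      push Not at hc
      exact hns ⟨hl, fun s s' a a' h1 h2 h3 => not_not.1 fun h4 =>
        h4 (hc s s' a a' h1 h2 h3)⟩
    obtain ⟨s, s', a, a', h1, h2, h3, h4⟩ := this
    have hs := C.le n _ hw s
    have hs' := C.le n _ hw s'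
    right
    by_cases h5 : s = s' → a < a'
    · exact ⟨((s, ⟨a, by omega⟩), (s', ⟨a', by omega⟩)), h5, hw, h1, h2, h3⟩
    · push Not at h5
      refine ⟨((s', ⟨a', by omega⟩), (s, ⟨a, by omega⟩)), fun h6 => ?_, hw, h2, h1, h3.symm⟩
      exact lt_of_le_of_ne (h5.2) fun h7 => h4 ⟨h5.1, h7.symm⟩
  · push Not at hl
    obtain ⟨s, hs⟩ := hl
    obtain ⟨i, hi⟩ := C.large n _ hw
    have hi' : R * (20 * m) < (w i).length := lt_of_mul_lt_mul_left' (h.trans_le hi)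
    refine .inl ⟨(s, i), ?_, hw, hs, hi'⟩
    change s ≠ i
    rintro rfl
    have := Nat.le_mul_of_pos_left (20 * m) hR
    omega

theorem ncard_biUnion_le {α β : Type} [Fintype β] (P : Set β) (f : β → Set α)
    {N : ℝ} (h0 : 0 ≤ N) (h : ∀ p ∈ P, ((f p).ncard : ℝ) ≤ N) :
    ((⋃ p ∈ P, f p).ncard : ℝ) ≤ Fintype.card β * N := by
  classical
  have e : (⋃ p ∈ P, f p) = ⋃ p ∈ P.toFinset, f p := by simp
  have h1 : (⋃ p ∈ P.toFinset, f p).ncard ≤ ∑ p ∈ P.toFinset, (f p).ncard :=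
    Finset.set_ncard_biUnion_le _ _
  rw [e]
  calc ((⋃ p ∈ P.toFinset, f p).ncard : ℝ) ≤ ∑ p ∈ P.toFinset, ((f p).ncard : ℝ) := by
        exact_mod_cast h1
    _ ≤ ∑ p ∈ P.toFinset, N := Finset.sum_le_sum fun p hp => h p (by simpa using hp)
    _ ≤ Fintype.card β * N := by
        rw [Finset.sum_const, nsmul_eq_mul]
        exact mul_le_mul_of_nonneg_right (by exact_mod_cast Finset.card_le_univ _) h0

/-- The number of families that are not well spread. -/
theorem ncard_level_diff_le [Fintype A] (hA : 2 ≤ Fintype.card A) {n m R : ℕ} (hR : 0 < R)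
    (h : Fintype.card ι * (R * (20 * m)) < n) :
    ((C.level A n \ {w | WellSpread m w}).ncard : ℝ) ≤ (C.level A n).ncard *
      ((Fintype.card ι : ℝ) ^ 2 / R + (Fintype.card ι * (n + 1) : ℝ) ^ 2 / 2 ^ m) := by
  have : Nonempty A := Fintype.card_pos_iff.1 (by omega)
  have hfin := C.finite_level (A := A) n
  rcases (C.level A n).eq_empty_or_nonempty with h0 | ⟨w, hw⟩
  · simp [h0]
  have hle : R * (20 * m) ≤ n := by
    obtain ⟨i, -⟩ := C.large n _ hw
    have := Nat.le_mul_of_pos_left (R * (20 * m)) (Fintype.card_pos_iff.2 ⟨i⟩)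
    omega
  have hR' : (0 : ℝ) < R := by exact_mod_cast hR
  have h1 := ncard_biUnion_le {p : ι × ι | p.1 ≠ p.2}
    (fun p => Short (C.level A n) (20 * m) (R * (20 * m)) p.1 p.2)
    (N := (C.level A n).ncard / R) (by positivity)
    fun p hp => by
      rw [le_div_iff₀ hR']
      exact_mod_cast C.ncard_short_mul_le hle hp
  have h2 := ncard_biUnion_le
    {p : (ι × Fin (n + 1)) × (ι × Fin (n + 1)) | p.1.1 = p.2.1 → p.1.2.1 < p.2.2.1}
    (fun p => Repeating (C.level A n) m p.1.1 p.1.2 p.2.1 p.2.2)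
    (N := (C.level A n).ncard / 2 ^ m) (by positivity)
    fun p hp => by
      rw [le_div_iff₀ (by positivity)]
      refine le_trans ?_ (Nat.cast_le.2 (ncard_repeating_mul_le hfin (m := m) hp))
      push_cast
      refine mul_le_mul_of_nonneg_left ?_ (Nat.cast_nonneg _)
      exact pow_le_pow_left₀ (by norm_num) (by exact_mod_cast hA) m
  have h3 : ((C.level A n \ {w | WellSpread m w}).ncard : ℝ) ≤ _ := Nat.cast_le.2 <|
    (Set.ncard_le_ncard (C.level_diff_subset hR h) ((Set.finite_union.2
      ⟨Set.toFinite _ |>.biUnion fun p _ => hfin.subset fun _ h => h.1,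
        Set.toFinite _ |>.biUnion fun p _ => hfin.subset fun _ h => h.1⟩))).trans
      (Set.ncard_union_le _ _)
  push_cast at h3
  refine (h3.trans (add_le_add h1 h2)).trans_eq ?_
  simp only [Fintype.card_prod, Fintype.card_fin]
  push_cast
  ring

/-- Almost all families of size `n` are well spread, for `m` about the square root of `n`. -/
theorem tendsto_wellSpread [Nonempty ι] [Fintype A] (hA : 2 ≤ Fintype.card A) :
    Tendsto (fun n => (({w | ∃ m, 0 < m ∧ WellSpread m w} ∩ C.level A n).ncard : ℝ) /
      ((C.level A n).ncard : ℝ)) atTop (𝓝 1) := by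
  have : Nonempty A := Fintype.card_pos_iff.1 (by omega)
  set c := Fintype.card ι with hc
  have hc0 : 0 < c := Fintype.card_pos
  have hsqrt : Tendsto Nat.sqrt atTop atTop :=
    tendsto_atTop.2 fun b => eventually_atTop.2 ⟨b * b, fun n hn => Nat.le_sqrt.2 hn⟩
  -- a bound for the proportion of the families that are not well spread, in terms of `m = √n`;
  -- the divisor of `m` is such that `ncard_level_diff_le` applies with `R = m / (40 * c)`
  let g : ℕ → ℝ := fun m => (c : ℝ) ^ 2 / (m / (40 * c) : ℕ) +
    (c : ℝ) ^ 2 * 2 * ((m + 1 : ℕ) ^ 4 / 2 ^ (m + 1))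
  have hg : Tendsto g atTop (𝓝 0) := by
    have h1 : Tendsto (fun m : ℕ => (c : ℝ) ^ 2 / (m / (40 * c) : ℕ)) atTop (𝓝 0) :=
      (tendsto_const_div_atTop_nhds_zero_nat _).comp
        (Nat.tendsto_div_const_atTop (by omega : 40 * c ≠ 0))
    have h2 := (tendsto_add_atTop_iff_nat 1).2
      (tendsto_pow_const_div_const_pow_of_one_lt 4 (one_lt_two : (1 : ℝ) < 2))
    simpa [g] using h1.add (h2.const_mul ((c : ℝ) ^ 2 * 2))
  have hlow : Tendsto (fun n => 1 - g (Nat.sqrt n)) atTop (𝓝 1) := by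
    simpa using (hg.comp hsqrt).const_sub 1
  refine tendsto_of_tendsto_of_tendsto_of_le_of_le' hlow tendsto_const_nhds ?_ ?_
  · filter_upwards [C.ncard_level_pos (A := A), hsqrt.eventually_ge_atTop (40 * c)] with n hn hm
    set m := Nat.sqrt n
    have hfin := C.finite_level (A := A) n
    have hn' : (0 : ℝ) < (C.level A n).ncard := by exact_mod_cast hn
    have hR : 0 < m / (40 * c) := Nat.div_pos hm (by omega)
    have hm0 : 0 < m := by omega
    have hb : c * (m / (40 * c) * (20 * m)) < n := by
      have h1 : m / (40 * c) * (40 * c) ≤ m := Nat.div_mul_le_self _ _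
      have h2 : m * m ≤ n := Nat.sqrt_le n
      have h3 := Nat.mul_le_mul_right m h1
      have h4 : 0 < m * m := Nat.mul_pos hm0 hm0
      have h5 : c * (m / (40 * c) * (20 * m)) * 2 = m / (40 * c) * (40 * c) * m := by ring
      omega
    have h1 := C.ncard_level_diff_le hA hR hb
    have h2 : ((c : ℝ) ^ 2 / (m / (40 * c) : ℕ) + (c * (n + 1) : ℝ) ^ 2 / 2 ^ m) ≤ g m := by
      have h3 : (n : ℝ) + 1 ≤ (m + 1 : ℕ) ^ 2 := by
        exact_mod_cast (Nat.succ_le_succ_sqrt' n)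
      have h4 : ((n : ℝ) + 1) ^ 2 ≤ (m + 1 : ℕ) ^ 4 := by
        calc ((n : ℝ) + 1) ^ 2 ≤ ((m + 1 : ℕ) ^ 2) ^ 2 := by gcongr
          _ = _ := by ring
      refine add_le_add le_rfl ?_
      rw [mul_pow, pow_succ (2 : ℝ) m]
      calc (c : ℝ) ^ 2 * ((n : ℝ) + 1) ^ 2 / 2 ^ m ≤ (c : ℝ) ^ 2 * (m + 1 : ℕ) ^ 4 / 2 ^ m := by
            gcongr
        _ = _ := by field_simp
    have h3 : (C.level A n).ncard ≤ ({w | ∃ m, 0 < m ∧ WellSpread m w} ∩ C.level A n).ncard +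
        (C.level A n \ {w | WellSpread m w}).ncard := by
      refine (Set.ncard_le_ncard ?_ ((hfin.inter_of_right _).union hfin.sdiff)).trans
        (Set.ncard_union_le _ _)
      intro w hw
      by_cases h : WellSpread m w
      · exact .inl ⟨⟨m, hm0, h⟩, hw⟩
      · exact .inr ⟨hw, h⟩
    have h4 : ((C.level A n).ncard : ℝ) ≤
        ({w | ∃ m, 0 < m ∧ WellSpread m w} ∩ C.level A n).ncard +
        (C.level A n \ {w | WellSpread m w}).ncard := by exact_mod_cast h3
    rw [le_div_iff₀ hn']
    have h5 := h1.trans (mul_le_mul_of_nonneg_left h2 hn'.le)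
    linarith
  · refine Eventually.of_forall fun n => div_le_one_of_le₀ ?_ (Nat.cast_nonneg _)
    exact_mod_cast Set.ncard_le_ncard Set.inter_subset_right (C.finite_level n)

end LengthClass

end WordFamily

/-! ### The length classes of the two stratifications -/

namespace WordFamily.LengthClass

open Function

variable {ι : Type} [Fintype ι] [DecidableEq ι]

theorem sum_update_add (ℓ : ι → ℕ) (i : ι) (x : ℕ) :
    ∑ j, update ℓ i x j + ℓ i = ∑ j, ℓ j + x := by
  have h1 := Finset.sum_update_of_mem (Finset.mem_univ i) ℓ x
  have h2 := Finset.add_sum_erase Finset.univ ℓ (Finset.mem_univ i)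
  rw [h1, ← h2, Finset.sdiff_singleton_eq_erase]
  ring

/-- The length vectors with sum `n` and entries at least `b`. -/
def sum (ι : Type) [Fintype ι] [DecidableEq ι] [Nonempty ι] (b : ℕ) (hb : b ≤ 1) :
    LengthClass ι where
  L n := {ℓ | (∀ i, b ≤ ℓ i) ∧ ∑ i, ℓ i = n}
  le n ℓ hℓ i := hℓ.2 ▸ Finset.single_le_sum (fun _ _ => Nat.zero_le _) (Finset.mem_univ i)
  large n ℓ hℓ := by
    obtain ⟨i, -, hi⟩ := Finset.exists_max_image Finset.univ ℓ Finset.univ_nonempty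
    refine ⟨i, ?_⟩
    rw [← hℓ.2]
    exact Finset.sum_le_card_nsmul _ _ _ hi
  extend := .inl fun n ℓ hℓ s i d hsi hd => by
    refine ⟨fun j => ?_, ?_⟩
    · by_cases hj : j = i
      · subst hj
        rw [update_self]
        omega
      · rw [update_of_ne hj]
        by_cases hj' : j = s
        · subst hj'
          rw [update_self]
          exact (hℓ.1 j).trans (Nat.le_add_right _ _)
        · rw [update_of_ne hj']
          exact hℓ.1 j
    · have h1 := sum_update_add ℓ s (ℓ s + d)
      have h2 := sum_update_add (update ℓ s (ℓ s + d)) i (ℓ i - d)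
      rw [update_of_ne hsi.symm] at h2
      have := hℓ.2
      omega
  nonempty := by
    refine eventually_atTop.2 ⟨Fintype.card ι, fun n hn => ?_⟩
    let i : ι := Classical.arbitrary ι
    have h := sum_update_add (fun _ => 1) i (n - Fintype.card ι + 1)
    refine ⟨update (fun _ => 1) i (n - Fintype.card ι + 1), fun j => ?_, ?_⟩
    · by_cases hj : j = i
      · subst hj
        rw [update_self]
        omega
      · rw [update_of_ne hj]
        exact hb
    · simp only [Finset.sum_const, Finset.card_univ, smul_eq_mul, mul_one] at h
      omega

/-- The length vectors with maximum `n` and entries at least `b`. -/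
def max (ι : Type) [Fintype ι] [DecidableEq ι] [Nonempty ι] (b : ℕ) (hb : b ≤ 1) :
    LengthClass ι where
  L n := {ℓ | (∀ i, b ≤ ℓ i) ∧ Finset.univ.sup ℓ = n}
  le n ℓ hℓ i := hℓ.2 ▸ Finset.le_sup (Finset.mem_univ i)
  large n ℓ hℓ := by
    obtain ⟨i, -, hi⟩ := Finset.exists_mem_eq_sup Finset.univ Finset.univ_nonempty ℓ
    refine ⟨i, ?_⟩
    rw [← hℓ.2, hi]
    exact Nat.le_mul_of_pos_left _ Fintype.card_pos
  extend := .inr fun n ℓ hℓ s d hd => by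
    obtain ⟨i, -, hi⟩ := Finset.exists_mem_eq_sup Finset.univ Finset.univ_nonempty ℓ
    refine ⟨fun j => ?_, le_antisymm (Finset.sup_le fun j _ => ?_) ?_⟩
    · by_cases hj : j = s
      · subst hj
        rw [update_self]
        exact (hℓ.1 j).trans (Nat.le_add_right _ _)
      · rw [update_of_ne hj]
        exact hℓ.1 j
    · by_cases hj : j = s
      · subst hj
        rw [update_self]
        exact hd.le
      · rw [update_of_ne hj, ← hℓ.2]
        exact Finset.le_sup (Finset.mem_univ j)
    · have his : i ≠ s := by
        rintro rfl
        have := hℓ.2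
        omega
      rw [← hℓ.2, hi, ← update_of_ne his (ℓ s + d) ℓ]
      exact Finset.le_sup (Finset.mem_univ i)
  nonempty := by
    refine eventually_atTop.2 ⟨1, fun n hn => ⟨fun _ => n, fun _ => hb.trans hn, ?_⟩⟩
    exact Finset.sup_const Finset.univ_nonempty n

/-- A property of the objects of a stratified set is generic if it holds for the objects that
belong to well spread families, provided that the objects of size `n` correspond to the families of
size `n`. -/
theorem genericHas {A T : Type} [Fintype A] [Nonempty ι] (hA : 2 ≤ Fintype.card A)
    (C : LengthClass ι) (σ : Stratification T) {φ : T → ι → List A} (hφ : Injective φ)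
    (hlevel : ∀ n x, x ∈ σ.level n ↔ φ x ∈ C.level A n)
    (hrange : ∀ n, C.level A n ⊆ Set.range φ) {p : T → Prop}
    (hp : ∀ x m, 0 < m → WellSpread m (φ x) → p x) : σ.GenericHas p := by
  refine ⟨φ ⁻¹' {w | ∃ m, 0 < m ∧ WellSpread m w}, ?_, fun x ⟨m, hm, h⟩ => hp x m hm h⟩
  have e (n : ℕ) : φ '' σ.level n = C.level A n := by
    have : σ.level n = φ ⁻¹' C.level A n := Set.ext (hlevel n)
    rw [this, Set.image_preimage_eq_of_subset (hrange n)]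
  have e1 (n : ℕ) : (σ.level n).ncard = (C.level A n).ncard := by
    rw [← e, Set.ncard_image_of_injective _ hφ]
  have e2 (n : ℕ) : (φ ⁻¹' {w | ∃ m, 0 < m ∧ WellSpread m w} ∩ σ.level n).ncard =
      ({w | ∃ m, 0 < m ∧ WellSpread m w} ∩ C.level A n).ncard := by
    rw [← Set.ncard_image_of_injective _ hφ, Set.image_preimage_inter, e]
  simpa only [Stratification.IsGeneric, e1, e2] using C.tendsto_wellSpread hA

end WordFamily.LengthClass

/-! ### Presentations whose relation words are well spread -/

theorem DecidableInLinearTime.comap {α β Γ : Type} {enc : α → List Γ} {P : α → Prop}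
    (h : DecidableInLinearTime enc P) (f : β → α) :
    DecidableInLinearTime (fun b => enc (f b)) (fun b => P (f b)) := by
  obtain ⟨M, C, hC⟩ := h
  exact ⟨{ M with outputsFun := fun b => M.outputsFun (f b) }, C, hC⟩

namespace MonoidPresentation

variable {A : Type} {k : ℕ}

/-- The family of the relation words. -/
def words (P : MonoidPresentation A k) : Fin k × Bool → List A :=
  fun s => if s.2 then (P s.1).2 else (P s.1).1

theorem words_injective : Function.Injective (words : MonoidPresentation A k → _) := by
  intro P Q h
  funext i
  exact Prod.ext (congrFun h (i, false)) (congrFun h (i, true))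

theorem words_surjective : Function.Surjective (words : MonoidPresentation A k → _) := by
  intro w
  refine ⟨fun i => (w (i, false), w (i, true)), ?_⟩
  funext ⟨i, b⟩
  cases b <;> rfl

theorem sumLength_eq (P : MonoidPresentation A k) :
    P.sumLength = ∑ s, (P.words s).length := by
  rw [Fintype.sum_prod_type]
  simp [sumLength, words, add_comm]

theorem maxLength_eq (P : MonoidPresentation A k) :
    P.maxLength = Finset.univ.sup fun s => (P.words s).length := by
  apply le_antisymm
  · refine Finset.sup_le fun i _ => max_le ?_ ?_
    · exact Finset.le_sup (f := fun s => (P.words s).length) (Finset.mem_univ (i, false))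
    · exact Finset.le_sup (f := fun s => (P.words s).length) (Finset.mem_univ (i, true))
  · refine Finset.sup_le fun ⟨i, b⟩ _ => ?_
    refine le_trans ?_ (Finset.le_sup (f := fun i => max (P i).1.length (P i).2.length)
      (Finset.mem_univ i))
    cases b
    · exact le_max_left _ _
    · exact le_max_right _ _

/-- A presentation whose relation words are well spread satisfies the small overlap condition. -/
def smallOverlap (P : MonoidPresentation A k) {m : ℕ} (hm : 0 < m)
    (h : WordFamily.WellSpread m P.words) : SmallOverlap A (Fin k × Bool) where
  rel := P.words
  bar s := (s.1, !s.2)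
  bar_bar s := by simp
  bar_ne s h := by simpa using congrArg Prod.snd h
  m := m
  m_pos := hm
  long := h.1
  uniq := h.2

theorem oneStep_iff (P : MonoidPresentation A k) {m : ℕ} (hm : 0 < m)
    (h : WordFamily.WellSpread m P.words) (u v : List A) :
    (P.smallOverlap hm h).Step u v ↔ P.OneStep u v := by
  constructor
  · rintro ⟨a, b, ⟨i, c⟩, rfl, rfl⟩
    refine ⟨a, b, P.words (i, c), P.words (i, !c), i, ?_, by simp [smallOverlap],
      by simp [smallOverlap]⟩
    cases c
    · exact .inl rfl
    · exact .inr rfl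
  · rintro ⟨a, b, x, y, i, hi | hi, rfl, rfl⟩
    · exact ⟨a, b, (i, false), by simp [smallOverlap, words, hi], by simp [smallOverlap, words, hi]⟩
    · exact ⟨a, b, (i, true), by simp [smallOverlap, words, hi], by simp [smallOverlap, words, hi]⟩

theorem wordProblemLinearTime_of_wellSpread [Fintype A] [Nonempty A] (P : MonoidPresentation A k)
    {m : ℕ} (hm : 0 < m) (h : WordFamily.WellSpread m P.words) : P.WordProblemLinearTime := by
  have e : (P.smallOverlap hm h).Step = P.OneStep :=
    funext fun u => funext fun v => propext (P.oneStep_iff hm h u v)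
  have := (P.smallOverlap hm h).decidableInLinearTime
  rw [e] at this
  exact this

end MonoidPresentation

namespace SemigroupPresentation

variable {A : Type} {k : ℕ}

theorem equivalent_iff_toMonoid (P : SemigroupPresentation A k) (u v : NonemptyWord A) :
    P.toMonoid.Equivalent u.1 v.1 ↔ P.Equivalent u v := by
  constructor
  · intro h
    suffices ∀ w, P.toMonoid.Equivalent u.1 w → ∃ hw : w ≠ [], P.Equivalent u ⟨w, hw⟩ from
      (this v.1 h).2
    intro w hw
    induction hw with
    | refl => exact ⟨u.2, .refl⟩
    | tail _ h ih =>
      obtain ⟨hw, ih⟩ := ih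
      obtain ⟨a, b, x, y, i, hi, hx, hy⟩ := h
      have hne : x ≠ [] ∧ y ≠ [] ∧ ∃ hx hy, P i = (⟨x, hx⟩, ⟨y, hy⟩) ∨ P i = (⟨y, hy⟩, ⟨x, hx⟩) := by
        rcases hi with hi | hi <;> simp only [toMonoid, Prod.mk.injEq] at hi <;>
          obtain ⟨rfl, rfl⟩ := hi
        · exact ⟨(P i).1.2, (P i).2.2, (P i).1.2, (P i).2.2, .inl rfl⟩
        · exact ⟨(P i).2.2, (P i).1.2, (P i).2.2, (P i).1.2, .inr rfl⟩
      obtain ⟨hx0, hy0, hx1, hy1, hi⟩ := hne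
      refine ⟨by simp [hy, hy0], ih.tail ⟨a, b, ⟨x, hx0⟩, ⟨y, hy0⟩, i, hi, hx, hy⟩⟩
  · intro h
    induction h with
    | refl => exact .refl
    | tail _ h ih =>
      obtain ⟨a, b, x, y, i, hi, hx, hy⟩ := h
      refine ih.tail ⟨a, b, x.1, y.1, i, ?_, hx, hy⟩
      rcases hi with hi | hi <;> simp [toMonoid, hi]

theorem wordProblemLinearTime_of_toMonoid {P : SemigroupPresentation A k}
    (h : P.toMonoid.WordProblemLinearTime) : P.WordProblemLinearTime := by
  have := h.comap fun p : NonemptyWord A × NonemptyWord A => (p.1.1, p.2.1)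
  simp only [equivalent_iff_toMonoid] at this
  exact this

theorem mem_range_words_toMonoid {w : Fin k × Bool → List A} (h : ∀ s, 1 ≤ (w s).length) :
    w ∈ Set.range fun P : SemigroupPresentation A k => P.toMonoid.words := by
  have h' (s) : w s ≠ [] := List.length_pos_iff.1 (h s)
  refine ⟨fun i => (⟨w (i, false), h' _⟩, ⟨w (i, true), h' _⟩), ?_⟩
  funext ⟨i, b⟩
  cases b <;> rfl

theorem one_le_length_words (P : SemigroupPresentation A k) (s : Fin k × Bool) :
    1 ≤ (P.toMonoid.words s).length := by
  obtain ⟨i, b⟩ := s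
  cases b
  · exact List.length_pos_iff.2 (P i).1.2
  · exact List.length_pos_iff.2 (P i).2.2

end SemigroupPresentation

theorem mainTheorem5 (A : Type) [Fintype A] (hA : 2 ≤ Fintype.card A) (k : ℕ) (hk : 0 < k) :
    ((MonoidPresentation.sumLengthStratification A k).GenericHas
        (fun P : MonoidPresentation A k => P.WordProblemLinearTime) ∧
      (MonoidPresentation.maxLengthStratification A k).GenericHas
        (fun P : MonoidPresentation A k => P.WordProblemLinearTime)) ∧
    ((SemigroupPresentation.sumLengthStratification A k).GenericHas
        (fun P : SemigroupPresentation A k => P.WordProblemLinearTime) ∧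
      (SemigroupPresentation.maxLengthStratification A k).GenericHas
        (fun P : SemigroupPresentation A k => P.WordProblemLinearTime)) := by
  have : Nonempty A := Fintype.card_pos_iff.1 (by omega)
  have : NeZero k := ⟨hk.ne'⟩
  have hM (P : MonoidPresentation A k) (m : ℕ) (hm : 0 < m)
      (h : WordFamily.WellSpread m P.words) : P.WordProblemLinearTime :=
    P.wordProblemLinearTime_of_wellSpread hm h
  have hS (P : SemigroupPresentation A k) (m : ℕ) (hm : 0 < m)
      (h : WordFamily.WellSpread m P.toMonoid.words) : P.WordProblemLinearTime :=
    SemigroupPresentation.wordProblemLinearTime_of_toMonoid (hM P.toMonoid m hm h)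
  have hinj : Function.Injective fun P : SemigroupPresentation A k => P.toMonoid.words :=
    MonoidPresentation.words_injective.comp SemigroupPresentation.toMonoid_injective
  have hrange (w) : w ∈ Set.range (MonoidPresentation.words (A := A) (k := k)) :=
    MonoidPresentation.words_surjective w
  refine ⟨⟨?_, ?_⟩, ?_, ?_⟩
  · refine (WordFamily.LengthClass.sum (Fin k × Bool) 0 zero_le_one).genericHas hA _
      MonoidPresentation.words_injective (fun n P => ?_) (fun n w _ => hrange w) hM
    change P.sumLength = n ↔ _ ∧ _
    rw [P.sumLength_eq]
    exact (and_iff_right fun _ => Nat.zero_le _).symm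
  · refine (WordFamily.LengthClass.max (Fin k × Bool) 0 zero_le_one).genericHas hA _
      MonoidPresentation.words_injective (fun n P => ?_) (fun n w _ => hrange w) hM
    change P.maxLength = n ↔ _ ∧ _
    rw [P.maxLength_eq]
    exact (and_iff_right fun _ => Nat.zero_le _).symm
  · refine (WordFamily.LengthClass.sum (Fin k × Bool) 1 le_rfl).genericHas hA _
      hinj (fun n P => ?_)
      (fun n w hw => SemigroupPresentation.mem_range_words_toMonoid hw.1) hS
    change P.toMonoid.sumLength = n ↔ _ ∧ _
    rw [P.toMonoid.sumLength_eq]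
    exact (and_iff_right P.one_le_length_words).symm
  · refine (WordFamily.LengthClass.max (Fin k × Bool) 1 le_rfl).genericHas hA _
      hinj (fun n P => ?_)
      (fun n w hw => SemigroupPresentation.mem_range_words_toMonoid hw.1) hS
    change P.toMonoid.maxLength = n ↔ _ ∧ _
    rw [P.toMonoid.maxLength_eq]
    exact (and_iff_right P.one_le_length_words).symm
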